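/- **Conventions.** All Banach spaces are real and $\mathbb N=\{1,2,\dots\}$. A sequence ${\mathbf E}=(E_i)_{i=1}^\infty$ of finite-dimensional subspaces of a Banach space $X$ (some may be $\{0\}$) is an *FDD* for $X$ if every $x\in X$ can be written uniquely as $x=\sum_{i=1}^\infty x_i$ with $x_i\in E_i$. Write $P_n x=x_n$, and $P_B=\sum_{n\in B}P_n$ for finite $B$. The FDD is *bimonotone* if $\|P_{[m,n]}\|\le 1$ for all $m\le n$. Let $E_i^*\subset X^*$ denote $\{f\circ P_i: f\in X^*\}$, let $c_{00}(\oplus E_i^*)$ be the linear span of the $E_i^*$, and put $P_n^*f=f\circ P_n$. The FDD is *shrinking* if $c_{00}(\oplus E_i^*)$ is norm dense in $X^*$. Supports are ${\rm supp}(z)=\{n:P_nz\ne0\}$ for $z$ in the linear span $c_{00}(\oplus E_i)$ and ${\rm supp}(f)=\{n: P_n^*f\neq 0\}$ for $f\in c_{00}(\oplus E_i^*)$. A (finite or infinite) sequence of non-zero vectors of $c_{00}(\oplus E_i)$, or of $c_{00}(\oplus E_i^*)$, is a *block sequence* if the supports are successive (all elements of one support are smaller than all elements of the next ones). $B_{X^*}$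 is the closed unit ball of $X^*$. A set $D\subset B_{X^*}$ is *$d$-norming* if $d\|z\|\le\sup\{|f(z)|:f\in D\}$ for all $z\in X$. A family ${\mathcal A}$ of finite subsets of $\mathbb N$ is *regular* if it contains all singletons, is compact in $\{0,1\}^{\mathbb N}$ (product topology), is hereditary (closed under subsets) and spreading (if $\{a_1<\dots<a_n\}\in{\mathcal A}$, $b_1<\dots<b_n$ and $a_i\le b_i$ for all $i$, then $\{b_1,\dots,b_n\}\in{\mathcal A}$). Non-empty sets $A_1<\dots<A_n$ of natural numbers are *${\mathcal A}$-admissible* if $\{\min A_1,\dots,\min A_n\}\in{\mathcal A}$. Let $0<c<1$ and $f\in c_{00}(\oplus E_i^*)$. A *$c$-decomposition* of $f$ is a finite block sequence $(f_1,\dots,f_\ell)$ (empty if $f=0$) with $f=\sum_i f_i$ such that for every $i$ either $|{\rm supp}(f_i)|=1$ or $\|f_i\|\le c$; it is ${\mathcal A}$-admissible if $({\rm supp}(f_i))_i$ is. The *optimal $c$-decomposition* of $f\neq 0$ is defined by $n_1=\min{\rm supp}(f)$ and $$n_{j+1}=\begin{cases} n_j+1 &\text{if }\|P^*_{n_j}f\|>c,\\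 \min\{n\ge n_j:\|P^*_{[n_j,n]}f\|>c\}&\text{if }\|P^*_{n_j}f\|\le c\text{ and the minimum exists},\\ 1+\max{\rm supp}(f)&\text{otherwise,}\end{cases}$$ until $n_{\ell+1}=1+\max{\rm supp}(f)$ for the first time; it consists of the non-zero ones among the functionals $P^*_{[n_j,n_{j+1})}f$, $1\le j\le \ell$. The optimal $c$-decomposition of $0$ is empty. Fix for every countable limit ordinal $\alpha$ a sequence $\alpha_1<\alpha_2<\cdots$ of ordinals with $\sup_n\alpha_n=\alpha$. The *Schreier families* are: $S_0$, the sets with at most one element; $S_{\alpha+1}$, the unions $A_1\cup\dots\cup A_n$ with $n\le A_1<\dots<A_n$ and $A_i\in S_\alpha$ (together with $\emptyset$); and, for a limit $\alpha$, $S_\alpha=\{A:\ A\in S_{\alpha_n}\text{ and }n\le A\text{ for some }n\ge 1\}$. For $0<c<1$, the *Tsirelson space* $T_{c,\alpha}$ is the completion of the space $c_{00}$ of finitely supported real sequences under the norm given implicitly by $$\|x\|=\max\Big(\|x\|_\infty,\ \sup\Big\{\sum_{i=1}^n c\,\|x|_{A_i}\|:\ n\in\mathbb N,\ A_1<\dots<A_n\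 \text{finite and } S_\alpha\text{-admissible}\Big\}\Big),$$ and $(t_i)$ is its unit vector basis. For a sequence $(v_i)$ in a Banach space and $C\ge1$, the FDD *satisfies subsequential $C$-$(v_i)$ upper estimates* if for every infinite block sequence $(z_i)$ of ${\mathbf E}$ with $\|z_i\|=1$, with $m_i=\min{\rm supp}(z_i)$, one has $\|\sum_i a_iz_i\|\le C\|\sum_i a_iv_{m_i}\|$ for all finitely supported real $(a_i)$. **Theorem.** Let ${\mathbf E}=(E_i)_{i=1}^\infty$ be a bimonotone FDD for a Banach space $X$. For any choice of the sequences $(\alpha_n)$ above, the following statements are equivalent. (a) $(E_i)$ is shrinking. (b) For all $0<c<1$ there is a regular family ${\mathcal A}$ such that for every $x^*\in B_{X^*}\cap c_{00}(\oplus E_i^*)$ the optimal $c$-decomposition of $x^*$ is ${\mathcal A}$-admissible. (c) There are $D\subset B_{X^*}\cap c_{00}(\oplus E_i^*)$, $0<c<d\le1$ and a regular family ${\mathcal A}$ such that $D$ is $d$-norming for $X$ and every $x^*\in D$ admits an ${\mathcal A}$-admissible $c$-decomposition. (d) There are $\alpha<\omega_1$, $0<c<1$, $C\ge1$ and a subsequence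 $(t_{m_i})_{i=1}^\infty$ of the unit vector basis of $T_{c,\alpha}$ such that $(E_i)$ satisfies subsequential $C$-$(t_{m_i})_{i=1}^\infty$ upper estimates. -/

import Mathlib

open Filter Topology
open scoped Ordinal

noncomputable section

namespace BimonotoneFDD

/-! ### Finite dimensional decompositions

The positive integers of the literature are modelled by `ℕ`: the natural number `i` stands for the
`(i + 1)`-st index.  All Banach spaces are real. -/

/-- A finite dimensional decomposition of `X`: a sequence of finite dimensional subspaces such that
every `x` has a unique expansion `x = ∑ xₙ` (convergence of the partial sums) with `xₙ` in the `n`-th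
subspace.  Some of the subspaces may be zero. -/
structure FDD (X : Type*) [NormedAddCommGroup X] [NormedSpace ℝ X] where
  space : ℕ → Submodule ℝ X
  finiteDimensional : ∀ n, FiniteDimensional ℝ (space n)
  existsUnique_expansion : ∀ x : X, ∃! y : ℕ → X, (∀ n, y n ∈ space n) ∧
    Tendsto (fun N => ∑ n ∈ Finset.range N, y n) atTop (𝓝 x)

namespace FDD

variable {X : Type*} [NormedAddCommGroup X] [NormedSpace ℝ X] (E : FDD X)

/-- The sequence of components of `x`. -/
def coord (x : X) : ℕ → X := (E.existsUnique_expansion x).choose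

theorem coord_mem (x : X) (n : ℕ) : E.coord x n ∈ E.space n :=
  (E.existsUnique_expansion x).choose_spec.1.1 n

theorem tendsto_coord (x : X) :
    Tendsto (fun N => ∑ n ∈ Finset.range N, E.coord x n) atTop (𝓝 x) :=
  (E.existsUnique_expansion x).choose_spec.1.2

theorem coord_eq {x : X} {y : ℕ → X} (hy : ∀ n, y n ∈ E.space n)
    (h : Tendsto (fun N => ∑ n ∈ Finset.range N, y n) atTop (𝓝 x)) : y = E.coord x :=
  (E.existsUnique_expansion x).choose_spec.2 y ⟨hy, h⟩

/-- The coordinate projections as linear maps. -/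
def coordLinear (n : ℕ) : X →ₗ[ℝ] X where
  toFun x := E.coord x n
  map_add' x y := by
    have h := E.coord_eq (x := x + y) (y := fun n => E.coord x n + E.coord y n)
      (fun n => (E.space n).add_mem (E.coord_mem x n) (E.coord_mem y n))
      (by simpa [Finset.sum_add_distrib] using (E.tendsto_coord x).add (E.tendsto_coord y))
    exact (congrFun h n).symm
  map_smul' a x := by
    have h := E.coord_eq (x := a • x) (y := fun n => a • E.coord x n)
      (fun n => (E.space n).smul_mem a (E.coord_mem x n))
      (by simpa [Finset.smul_sum] using (E.tendsto_coord x).const_smul a)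
    exact (congrFun h n).symm

/-- The space of convergent sequences of partial sums of series `∑ yₙ` with `yₙ ∈ Eₙ`, together with
their limits. -/
def partialSums : Submodule ℝ C(OnePoint ℕ, X) where
  carrier := {s | s ((0 : ℕ) : OnePoint ℕ) = 0 ∧
    ∀ n : ℕ, s ((n + 1 : ℕ) : OnePoint ℕ) - s (n : OnePoint ℕ) ∈ E.space n}
  add_mem' {s t} hs ht := by
    refine ⟨by simp [hs.1, ht.1], fun n => ?_⟩
    have := (E.space n).add_mem (hs.2 n) (ht.2 n)
    simpa [add_sub_add_comm] using this
  zero_mem' := by simp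
  smul_mem' a s hs := by
    refine ⟨by simp [hs.1], fun n => ?_⟩
    have := (E.space n).smul_mem a (hs.2 n)
    simpa [smul_sub] using this

theorem isClosed_partialSums : IsClosed (E.partialSums : Set C(OnePoint ℕ, X)) := by
  have h : (E.partialSums : Set C(OnePoint ℕ, X)) =
      {s | s ((0 : ℕ) : OnePoint ℕ) = 0} ∩ ⋂ n : ℕ,
        (fun s : C(OnePoint ℕ, X) => s ((n + 1 : ℕ) : OnePoint ℕ) - s (n : OnePoint ℕ)) ⁻¹'
          (E.space n : Set X) := by
    ext s
    simp [partialSums]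
  rw [h]
  refine (isClosed_eq (by fun_prop) continuous_const).inter (isClosed_iInter fun n => ?_)
  have := E.finiteDimensional n
  exact (Submodule.closed_of_finiteDimensional (E.space n)).preimage (by fun_prop)

/-- The limit of a convergent sequence of partial sums. -/
def limitMap : E.partialSums →L[ℝ] X :=
  (ContinuousMap.evalCLM ℝ (OnePoint.infty : OnePoint ℕ)).comp E.partialSums.subtypeL

theorem sum_range_eq (s : E.partialSums) (N : ℕ) :
    ∑ n ∈ Finset.range N, ((s : C(OnePoint ℕ, X)) ((n + 1 : ℕ) : OnePoint ℕ)
      - (s : C(OnePoint ℕ, X)) (n : OnePoint ℕ)) = (s : C(OnePoint ℕ, X)) (N : OnePoint ℕ) := by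
  rw [Finset.sum_range_sub (fun n : ℕ => (s : C(OnePoint ℕ, X)) (n : OnePoint ℕ)), s.2.1, sub_zero]

theorem coord_limitMap (s : E.partialSums) (n : ℕ) :
    E.coord (E.limitMap s) n = (s : C(OnePoint ℕ, X)) ((n + 1 : ℕ) : OnePoint ℕ)
      - (s : C(OnePoint ℕ, X)) (n : OnePoint ℕ) := by
  refine (congrFun (E.coord_eq (x := E.limitMap s) (y := fun n =>
    (s : C(OnePoint ℕ, X)) ((n + 1 : ℕ) : OnePoint ℕ)
      - (s : C(OnePoint ℕ, X)) (n : OnePoint ℕ)) s.2.2 ?_) n).symm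
  simp only [E.sum_range_eq]
  exact (OnePoint.continuous_iff_from_nat _).1 (s : C(OnePoint ℕ, X)).continuous

theorem limitMap_bijective : Function.Bijective E.limitMap := by
  constructor
  · intro s t hst
    have key : ∀ n : ℕ, (s : C(OnePoint ℕ, X)) (n : OnePoint ℕ)
        = (t : C(OnePoint ℕ, X)) (n : OnePoint ℕ) := by
      intro n
      rw [← E.sum_range_eq s n, ← E.sum_range_eq t n]
      refine Finset.sum_congr rfl fun k _ => ?_
      rw [← E.coord_limitMap, ← E.coord_limitMap, hst]
    refine Subtype.ext (ContinuousMap.ext fun p => ?_)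
    induction p using OnePoint.rec with
    | infty => exact hst
    | coe n => exact key n
  · intro x
    refine ⟨⟨OnePoint.continuousMapMkNat (fun N => ∑ n ∈ Finset.range N, E.coord x n) x
      (E.tendsto_coord x), ?_, ?_⟩, ?_⟩
    · change ∑ n ∈ Finset.range 0, E.coord x n = 0
      simp
    · intro n
      change ∑ k ∈ Finset.range (n + 1), E.coord x k - ∑ k ∈ Finset.range n, E.coord x k ∈ _
      rw [Finset.sum_range_succ, add_sub_cancel_left]
      exact E.coord_mem x n
    · rfl

/-- The coordinate projections of a Banach space with an FDD are automatically continuous. -/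
theorem continuous_coord [CompleteSpace X] (n : ℕ) : Continuous fun x => E.coord x n := by
  have : CompleteSpace E.partialSums := E.isClosed_partialSums.completeSpace_coe
  let T := ContinuousLinearEquiv.ofBijective E.limitMap
    (LinearMap.ker_eq_bot.2 E.limitMap_bijective.1)
    (LinearMap.range_eq_top.2 E.limitMap_bijective.2)
  have h : (fun x => E.coord x n) = fun x => (T.symm x : C(OnePoint ℕ, X)) ((n + 1 : ℕ) : OnePoint ℕ)
      - (T.symm x : C(OnePoint ℕ, X)) (n : OnePoint ℕ) := by
    funext x
    rw [← E.coord_limitMap]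
    congr 1
    exact (T.apply_symm_apply x).symm
  rw [h]
  have hT : Continuous fun x => (T.symm x : C(OnePoint ℕ, X)) :=
    continuous_subtype_val.comp T.symm.continuous
  exact ((continuous_eval_const _).comp hT).sub
    ((continuous_eval_const _).comp hT)

variable [CompleteSpace X]

/-- The `n`-th coordinate projection `P_n : X → E_n ⊆ X`. -/
def proj (n : ℕ) : X →L[ℝ] X := ⟨E.coordLinear n, E.continuous_coord n⟩

/-- The adjoint projections `f ↦ f ∘ P_n` on the dual space.  The range of the `n`-th one is the
copy of the dual of `E_n` inside `X*`. -/
def dualProj (n : ℕ) : StrongDual ℝ X →L[ℝ] StrongDual ℝ X :=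
  ContinuousLinearMap.precomp ℝ (E.proj n)

end FDD

/-! ### Supports, block sequences and `c`-decompositions

These notions are defined for a sequence of projections `P` on a normed space `Z`; they are used
with the projections of an FDD and with the adjoint projections on the dual space. -/

section Blocks

variable {Z : Type*} [NormedAddCommGroup Z] [NormedSpace ℝ Z] (P : ℕ → Z →L[ℝ] Z)

/-- `c₀₀(⊕ Eₙ)`: the linear span of the ranges of the projections. -/
def c00 : Submodule ℝ Z := ⨆ n, (P n).range

/-- The support of a vector. -/
def supp (z : Z) : Set ℕ := {n | P n z ≠ 0}

/-- The projection `P_{[m, n)}`. -/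
def intervalProj (m n : ℕ) : Z →L[ℝ] Z := ∑ k ∈ Finset.Ico m n, P k

/-- Block sequences: non-zero vectors in `c₀₀(⊕ Eₙ)` with successive supports. -/
structure IsBlockSequence {ι : Type*} [LT ι] (z : ι → Z) : Prop where
  mem_c00 : ∀ i, z i ∈ c00 P
  ne_zero : ∀ i, z i ≠ 0
  lt : ∀ i j, i < j → ∀ a ∈ supp P (z i), ∀ b ∈ supp P (z j), a < b

/-- `(y_0, …, y_{ℓ-1})` is a `c`-decomposition of `x`. The empty sequence decomposes `0`. -/
structure IsCDecomposition (c : ℝ) (x : Z) {l : ℕ} (y : Fin l → Z) : Prop where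
  block : IsBlockSequence P y
  sum_eq : x = ∑ i, y i
  small : ∀ i, (supp P (y i)).ncard = 1 ∨ ‖y i‖ ≤ c

/-- `1 + max supp x`. -/
def suppEnd (x : Z) : ℕ := 1 + sSup (supp P x)

open scoped Classical in
/-- The cut point of the optimal `c`-decomposition of `x` that follows the cut point `n`. -/
def nextCut (c : ℝ) (x : Z) (n : ℕ) : ℕ :=
  if c < ‖P n x‖ then n + 1
  else if ∃ k, n ≤ k ∧ c < ‖intervalProj P n (k + 1) x‖ then
    sInf {k | n ≤ k ∧ c < ‖intervalProj P n (k + 1) x‖}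
  else suppEnd P x

/-- The cut points of the optimal `c`-decomposition of `x`, starting from `min supp x`. -/
def optCut (c : ℝ) (x : Z) : ℕ → ℕ
  | 0 => sInf (supp P x)
  | j + 1 => nextCut P c x (optCut c x j)

/-- The number of pieces of the optimal `c`-decomposition of `x`: the cut point with this index is the
first one equal to `1 + max supp x`. -/
def optLength (c : ℝ) (x : Z) : ℕ := sInf {l | optCut P c x l = suppEnd P x}

/-- The pieces of the optimal `c`-decomposition of `x`. -/
def optPiece (c : ℝ) (x : Z) (i : ℕ) : Z :=
  intervalProj P (optCut P c x i) (optCut P c x (i + 1)) x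

open scoped Classical in
/-- The set of the minima of the supports of the optimal `c`-decomposition of `x` (pieces that are
zero are not members of the decomposition). -/
def optMins (c : ℝ) (x : Z) : Finset ℕ :=
  ((Finset.range (optLength P c x)).filter fun i => optPiece P c x i ≠ 0).image
    fun i => sInf (supp P (optPiece P c x i))

end Blocks

/-! ### Families of finite sets -/

/-- The indicator function of a finite set, as a point of `{0,1}^ℕ`. -/
def indicator (A : Finset ℕ) : ℕ → Bool := fun n => decide (n ∈ A)

/-- Regular families: containing all singletons, compact in the pointwise topology, hereditary and
spreading. -/
structure IsRegular (𝒜 : Set (Finset ℕ)) : Prop where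
  singleton_mem : ∀ n, {n} ∈ 𝒜
  compact : IsCompact (indicator '' 𝒜)
  hereditary : ∀ A ∈ 𝒜, ∀ B, B ⊆ A → B ∈ 𝒜
  spreading : ∀ (n : ℕ) (a b : Fin n → ℕ), StrictMono a → StrictMono b → (∀ i, a i ≤ b i) →
    Finset.univ.image a ∈ 𝒜 → Finset.univ.image b ∈ 𝒜

/-- `A_0 < A_1 < ⋯ < A_{n-1}` are non-empty successive sets and `{min A_i} ∈ 𝒜`. -/
structure IsAdmissible (𝒜 : Set (Finset ℕ)) {n : ℕ} (A : Fin n → Set ℕ) : Prop where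
  nonempty : ∀ i, (A i).Nonempty
  lt : ∀ i j, i < j → ∀ a ∈ A i, ∀ b ∈ A j, a < b
  mins_mem : (Finset.univ.image fun i => sInf (A i)) ∈ 𝒜

/-- A choice, for every countable limit ordinal `α`, of a sequence of ordinals strictly increasing
to `α`, as it is needed in the definition of the Schreier families. -/
def IsFundamental (φ : Ordinal.{0} → ℕ → Ordinal.{0}) : Prop :=
  ∀ α < ω₁, Order.IsSuccLimit α →
    StrictMono (φ α) ∧ (∀ n, φ α n < α) ∧ ∀ β < α, ∃ n, β < φ α n

/-- The Schreier families `S_α` with respect to a choice `φ` of approximating sequences: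
`S_0` consists of the sets with at most one element, `S_{α+1}` of the unions
`A_1 ∪ ⋯ ∪ A_n` with `n ≤ A_1 < ⋯ < A_n` in `S_α`, and for a limit `α`, `S_α` consists of the sets
`A ∈ S_{α_n}` with `n ≤ A`.  Indices are shifted by one: the natural number `a` stands for `a + 1`. -/
def schreier (φ : Ordinal.{0} → ℕ → Ordinal.{0}) (α : Ordinal.{0}) : Set (Finset ℕ) :=
  Ordinal.limitRecOn (motive := fun _ => Set (Finset ℕ)) α
    {A | A.card ≤ 1}
    (fun _ S => {A | ∃ (n : ℕ) (B : Fin n → Finset ℕ), (∀ i, B i ∈ S) ∧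
      (∀ i j, i < j → ∀ a ∈ B i, ∀ b ∈ B j, a < b) ∧
      A = Finset.univ.biUnion B ∧ ∀ a ∈ A, n ≤ a + 1})
    (fun α _ S => {A | ∃ (n : ℕ) (h : φ α n < α), A ∈ S (φ α n) h ∧ ∀ a ∈ A, n + 1 ≤ a + 1})

/-! ### Tsirelson spaces -/

section Tsirelson

variable (𝒜 : Set (Finset ℕ)) (c : ℝ)

open scoped Classical in
/-- The sums `∑ c ‖A_i x‖` over the `𝒜`-admissible sequences `A_1 < ⋯ < A_n`, where `N` is in place of
the norm and `A x` is the restriction of `x` to `A`. -/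
def admissibleSums (N : (ℕ →₀ ℝ) → ℝ) (x : ℕ →₀ ℝ) : Set ℝ :=
  {r | ∃ (n : ℕ) (A : Fin n → Finset ℕ), IsAdmissible 𝒜 (fun i => (A i : Set ℕ)) ∧
    r = ∑ i, c * N (x.filter fun k => k ∈ A i)}

/-- The usual iteration that produces the Tsirelson norm. -/
def tsirelsonIter : ℕ → (ℕ →₀ ℝ) → ℝ
  | 0, x => ⨆ i, |x i|
  | k + 1, x => max (tsirelsonIter k x) (sSup (admissibleSums 𝒜 c (tsirelsonIter k) x))

/-- The Tsirelson norm of a finitely supported sequence. -/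
def tsirelsonNorm (x : ℕ →₀ ℝ) : ℝ := ⨆ k, tsirelsonIter 𝒜 c k x

/-! The Tsirelson norm is a norm and satisfies its implicit equation. -/

/-- The `ℓ₁`-norm, an upper bound for the Tsirelson norm. -/
def sumAbs (x : ℕ →₀ ℝ) : ℝ := ∑ i ∈ x.support, |x i|

theorem sumAbs_eq {s : Finset ℕ} {x : ℕ →₀ ℝ} (h : x.support ⊆ s) : sumAbs x = ∑ i ∈ s, |x i| :=
  Finset.sum_subset h fun i _ hi => by simp [Finsupp.notMem_support_iff.1 hi]

theorem abs_le_sumAbs (x : ℕ →₀ ℝ) (i : ℕ) : |x i| ≤ sumAbs x := by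
  by_cases hi : i ∈ x.support
  · exact Finset.single_le_sum (f := fun i => |x i|) (fun _ _ => abs_nonneg _) hi
  · rw [Finsupp.notMem_support_iff.1 hi, abs_zero]
    exact Finset.sum_nonneg fun _ _ => abs_nonneg _

/-- Seminorms on `c₀₀` dominated by the `ℓ₁`-norm. -/
structure IsGood (N : (ℕ →₀ ℝ) → ℝ) : Prop where
  nonneg : ∀ x, 0 ≤ N x
  le : ∀ x, N x ≤ sumAbs x
  add : ∀ x y, N (x + y) ≤ N x + N y
  smul : ∀ (a : ℝ) x, N (a • x) ≤ |a| * N x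

variable {𝒜 c}

open scoped Classical in
theorem sum_sumAbs_filter_le {n : ℕ} {A : Fin n → Finset ℕ}
    (hA : IsAdmissible 𝒜 (fun i => (A i : Set ℕ))) (x : ℕ →₀ ℝ) :
    ∑ i, sumAbs (x.filter fun k => k ∈ A i) ≤ sumAbs x := by
  have h1 : ∀ i, sumAbs (x.filter fun k => k ∈ A i)
      = ∑ k ∈ x.support, if k ∈ A i then |x k| else 0 := by
    intro i
    rw [sumAbs_eq (s := x.support) (by rw [Finsupp.support_filter]; exact Finset.filter_subset _ _)]
    refine Finset.sum_congr rfl fun k _ => ?_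
    by_cases hk : k ∈ A i <;> simp [hk]
  simp only [h1]
  rw [Finset.sum_comm]
  refine Finset.sum_le_sum fun k _ => ?_
  by_cases h : ∃ i, k ∈ A i
  · obtain ⟨i, hi⟩ := h
    rw [Finset.sum_eq_single i]
    · simp [hi]
    · intro j _ hj
      rw [if_neg]
      intro hkj
      rcases lt_or_gt_of_ne hj with h | h
      · exact lt_irrefl _ (hA.lt _ _ h k hkj k hi)
      · exact lt_irrefl _ (hA.lt _ _ h k hi k hkj)
    · simp
  · push Not at h
    simp [h]

theorem IsGood.mem_bounds (hc : c ∈ Set.Ioo (0 : ℝ) 1) {N : (ℕ →₀ ℝ) → ℝ} (hN : IsGood N)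
    {x : ℕ →₀ ℝ} {r : ℝ} (hr : r ∈ admissibleSums 𝒜 c N x) : 0 ≤ r ∧ r ≤ sumAbs x := by
  obtain ⟨n, A, hA, rfl⟩ := hr
  refine ⟨Finset.sum_nonneg fun i _ => mul_nonneg hc.1.le (hN.nonneg _), ?_⟩
  refine le_trans (Finset.sum_le_sum fun i _ => ?_) (sum_sumAbs_filter_le hA x)
  exact (mul_le_of_le_one_left (hN.nonneg _) hc.2.le).trans (hN.le _)

theorem IsGood.bddAbove (hc : c ∈ Set.Ioo (0 : ℝ) 1) {N : (ℕ →₀ ℝ) → ℝ} (hN : IsGood N)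
    (x : ℕ →₀ ℝ) : BddAbove (admissibleSums 𝒜 c N x) :=
  ⟨sumAbs x, fun _ hr => (hN.mem_bounds hc hr).2⟩

theorem isGood_sSup (hc : c ∈ Set.Ioo (0 : ℝ) 1) {N : (ℕ →₀ ℝ) → ℝ} (hN : IsGood N) :
    IsGood fun x => sSup (admissibleSums 𝒜 c N x) := by
  have h0 : ∀ x, 0 ≤ sSup (admissibleSums 𝒜 c N x) := fun x =>
    Real.sSup_nonneg fun r hr => (hN.mem_bounds hc hr).1
  refine ⟨h0, fun x => Real.sSup_le (fun r hr => (hN.mem_bounds hc hr).2)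
    (Finset.sum_nonneg fun _ _ => abs_nonneg _), fun x y => ?_, fun a x => ?_⟩
  · refine Real.sSup_le ?_ (add_nonneg (h0 x) (h0 y))
    rintro r ⟨n, A, hA, rfl⟩
    refine le_trans ?_ (add_le_add
      (le_csSup (hN.bddAbove hc x) ⟨n, A, hA, rfl⟩) (le_csSup (hN.bddAbove hc y) ⟨n, A, hA, rfl⟩))
    rw [← Finset.sum_add_distrib]
    refine Finset.sum_le_sum fun i _ => ?_
    rw [← mul_add, Finsupp.filter_add]
    exact mul_le_mul_of_nonneg_left (hN.add _ _) hc.1.le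
  · refine Real.sSup_le ?_ (mul_nonneg (abs_nonneg a) (h0 x))
    rintro r ⟨n, A, hA, rfl⟩
    refine le_trans ?_ (mul_le_mul_of_nonneg_left
      (le_csSup (hN.bddAbove hc x) ⟨n, A, hA, rfl⟩) (abs_nonneg a))
    rw [Finset.mul_sum]
    refine Finset.sum_le_sum fun i _ => ?_
    rw [mul_left_comm, Finsupp.filter_smul]
    exact mul_le_mul_of_nonneg_left (hN.smul _ _) hc.1.le

theorem isGood_iSup {N : ℕ → (ℕ →₀ ℝ) → ℝ} (hN : ∀ k, IsGood (N k)) :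
    IsGood fun x => ⨆ k, N k x := by
  have hb : ∀ x, BddAbove (Set.range fun k => N k x) := fun x =>
    ⟨sumAbs x, by rintro _ ⟨k, rfl⟩; exact (hN k).le x⟩
  exact ⟨fun x => Real.iSup_nonneg fun k => (hN k).nonneg x, fun x => ciSup_le fun k => (hN k).le x,
    fun x y => ciSup_le fun k => ((hN k).add x y).trans
      (add_le_add (le_ciSup (hb x) k) (le_ciSup (hb y) k)),
    fun a x => ciSup_le fun k => ((hN k).smul a x).trans
      (mul_le_mul_of_nonneg_left (le_ciSup (hb x) k) (abs_nonneg a))⟩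

theorem isGood_tsirelsonIter (hc : c ∈ Set.Ioo (0 : ℝ) 1) (k : ℕ) :
    IsGood (tsirelsonIter 𝒜 c k) := by
  induction k with
  | zero =>
    exact isGood_iSup (N := fun i x => |x i|) fun i => ⟨fun x => abs_nonneg _, fun x =>
      abs_le_sumAbs x i, fun x y => abs_add_le _ _, fun a x => (abs_mul _ _).le⟩
  | succ k ih =>
    have h := isGood_sSup (𝒜 := 𝒜) hc ih
    exact ⟨fun x => le_max_of_le_left (ih.nonneg x), fun x => max_le (ih.le x) (h.le x),
      fun x y => max_le
        ((ih.add x y).trans (add_le_add (le_max_left _ _) (le_max_left _ _)))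
        ((h.add x y).trans (add_le_add (le_max_right _ _) (le_max_right _ _))),
      fun a x => max_le
        ((ih.smul a x).trans (mul_le_mul_of_nonneg_left (le_max_left _ _) (abs_nonneg a)))
        ((h.smul a x).trans (mul_le_mul_of_nonneg_left (le_max_right _ _) (abs_nonneg a)))⟩

theorem isGood_tsirelsonNorm (hc : c ∈ Set.Ioo (0 : ℝ) 1) : IsGood (tsirelsonNorm 𝒜 c) :=
  isGood_iSup (isGood_tsirelsonIter hc)

theorem tsirelsonIter_le (hc : c ∈ Set.Ioo (0 : ℝ) 1) (k : ℕ) (x : ℕ →₀ ℝ) :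
    tsirelsonIter 𝒜 c k x ≤ tsirelsonNorm 𝒜 c x :=
  le_ciSup (f := fun k => tsirelsonIter 𝒜 c k x)
    ⟨sumAbs x, by rintro _ ⟨k, rfl⟩; exact (isGood_tsirelsonIter hc k).le x⟩ k

theorem abs_le_tsirelsonNorm (hc : c ∈ Set.Ioo (0 : ℝ) 1) (x : ℕ →₀ ℝ) (i : ℕ) :
    |x i| ≤ tsirelsonNorm 𝒜 c x :=
  (le_ciSup (f := fun i => |x i|)
    ⟨sumAbs x, by rintro _ ⟨i, rfl⟩; exact abs_le_sumAbs x i⟩ i).trans (tsirelsonIter_le hc 0 x)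

/-- The implicit equation of the Tsirelson norm. -/
theorem tsirelsonNorm_eq (hc : c ∈ Set.Ioo (0 : ℝ) 1) (x : ℕ →₀ ℝ) :
    tsirelsonNorm 𝒜 c x =
      max (⨆ i, |x i|) (sSup (admissibleSums 𝒜 c (tsirelsonNorm 𝒜 c) x)) := by
  have hg := isGood_tsirelsonNorm (𝒜 := 𝒜) hc
  apply le_antisymm
  · refine ciSup_le fun k => ?_
    induction k with
    | zero => exact le_max_left _ _
    | succ k ih =>
      refine max_le ih (le_max_of_le_right (Real.sSup_le ?_
        (Real.sSup_nonneg fun r hr => (hg.mem_bounds hc hr).1)))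
      rintro r ⟨n, A, hA, rfl⟩
      refine le_trans ?_ (le_csSup (hg.bddAbove hc x) ⟨n, A, hA, rfl⟩)
      exact Finset.sum_le_sum fun i _ =>
        mul_le_mul_of_nonneg_left (tsirelsonIter_le hc k _) hc.1.le
  · refine max_le (tsirelsonIter_le hc 0 x) (Real.sSup_le ?_ (hg.nonneg x))
    rintro r ⟨n, A, hA, rfl⟩
    have hlim : Tendsto (fun k => ∑ i, c * tsirelsonIter 𝒜 c k (x.filter fun k => k ∈ A i)) atTop
        (𝓝 (∑ i, c * tsirelsonNorm 𝒜 c (x.filter fun k => k ∈ A i))) := by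
      refine tendsto_finsetSum _ fun i _ => Tendsto.const_mul c ?_
      exact tendsto_atTop_ciSup (monotone_nat_of_le_succ fun k => le_max_left _ _)
        ⟨sumAbs _, by rintro _ ⟨k, rfl⟩; exact (isGood_tsirelsonIter hc k).le _⟩
    refine le_of_tendsto' hlim fun k => ?_
    exact (le_csSup ((isGood_tsirelsonIter hc k).bddAbove hc x) ⟨n, A, hA, rfl⟩).trans
      ((le_max_right _ _).trans (tsirelsonIter_le hc (k + 1) x))

/-- The space `c₀₀` of finitely supported sequences, equipped with the Tsirelson norm. -/
def PreTsirelson (_ : Set (Finset ℕ)) (_ : Set.Ioo (0 : ℝ) 1) : Type := ℕ →₀ ℝ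

instance (𝒜 : Set (Finset ℕ)) (c : Set.Ioo (0 : ℝ) 1) : AddCommGroup (PreTsirelson 𝒜 c) :=
  inferInstanceAs (AddCommGroup (ℕ →₀ ℝ))

instance (𝒜 : Set (Finset ℕ)) (c : Set.Ioo (0 : ℝ) 1) : Module ℝ (PreTsirelson 𝒜 c) :=
  inferInstanceAs (Module ℝ (ℕ →₀ ℝ))

instance (𝒜 : Set (Finset ℕ)) (c : Set.Ioo (0 : ℝ) 1) : Norm (PreTsirelson 𝒜 c) :=
  ⟨fun x => tsirelsonNorm 𝒜 c (show ℕ →₀ ℝ from x)⟩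

theorem tsirelsonCore (𝒜 : Set (Finset ℕ)) (c : Set.Ioo (0 : ℝ) 1) :
    NormedSpace.Core ℝ (PreTsirelson 𝒜 c) where
  norm_nonneg x := (isGood_tsirelsonNorm c.2).nonneg x
  norm_smul a x := by
    have h := (isGood_tsirelsonNorm (𝒜 := 𝒜) c.2).smul
    refine le_antisymm (h a x) ?_
    rcases eq_or_ne a 0 with rfl | ha
    · rw [norm_zero, zero_mul, zero_smul]
      exact (isGood_tsirelsonNorm (𝒜 := 𝒜) c.2).nonneg _
    · have h' := h a⁻¹ (a • (show ℕ →₀ ℝ from x))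
      rw [smul_smul, inv_mul_cancel₀ ha, one_smul, abs_inv] at h'
      have := mul_le_mul_of_nonneg_left h' (abs_nonneg a)
      rwa [← mul_assoc, mul_inv_cancel₀ (abs_ne_zero.2 ha), one_mul] at this
  norm_triangle x y := (isGood_tsirelsonNorm c.2).add x y
  norm_eq_zero_iff x := by
    constructor
    · intro h
      refine Finsupp.ext (f := (show ℕ →₀ ℝ from x)) fun i => ?_
      have := abs_le_tsirelsonNorm (𝒜 := 𝒜) c.2 x i
      exact abs_nonpos_iff.1 (this.trans h.le)
    · rintro rfl
      refine le_antisymm ?_ ((isGood_tsirelsonNorm c.2).nonneg _)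
      exact ((isGood_tsirelsonNorm c.2).le 0).trans (by simp [sumAbs])

instance (𝒜 : Set (Finset ℕ)) (c : Set.Ioo (0 : ℝ) 1) : NormedAddCommGroup (PreTsirelson 𝒜 c) :=
  NormedAddCommGroup.ofCore (tsirelsonCore 𝒜 c)

instance (𝒜 : Set (Finset ℕ)) (c : Set.Ioo (0 : ℝ) 1) : NormedSpace ℝ (PreTsirelson 𝒜 c) :=
  NormedSpace.ofCore (tsirelsonCore 𝒜 c)

/-- The Tsirelson space `T_{𝒜,c}`, the completion of `c₀₀` under the Tsirelson norm. -/
abbrev TsirelsonSpace (𝒜 : Set (Finset ℕ)) (c : Set.Ioo (0 : ℝ) 1) : Type :=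
  UniformSpace.Completion (PreTsirelson 𝒜 c)

/-- The unit vector basis `(t_i)` of `T_{𝒜,c}`. -/
def tsirelsonBasis (𝒜 : Set (Finset ℕ)) (c : Set.Ioo (0 : ℝ) 1) (i : ℕ) : TsirelsonSpace 𝒜 c :=
  ((show PreTsirelson 𝒜 c from Finsupp.single i 1 : PreTsirelson 𝒜 c) : TsirelsonSpace 𝒜 c)

end Tsirelson

/-! ### Properties of FDDs -/

namespace FDD

variable {X : Type*} [NormedAddCommGroup X] [NormedSpace ℝ X] [CompleteSpace X] (E : FDD X)

/-- All projections onto intervals have norm at most one (for `X ≠ 0` this says that the projection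
constant is `1`). -/
def IsBimonotone : Prop := ∀ m n, ‖intervalProj E.proj m n‖ ≤ 1

/-- The FDD is shrinking: `c₀₀(⊕ Eₙ*)` is norm dense in `X*`. -/
def IsShrinking : Prop := Dense (c00 E.dualProj : Set (StrongDual ℝ X))

/-- Subsequential `C`-`V`-upper estimates, with respect to a sequence `v` in the space `V`: every
normalized block sequence `z` of `E` is `C`-dominated by `(v_{min supp z_i})`. -/
def HasUpperEstimates {V : Type*} [NormedAddCommGroup V] [NormedSpace ℝ V] (C : ℝ) (v : ℕ → V) :
    Prop :=
  ∀ z : ℕ → X, IsBlockSequence E.proj z → (∀ i, ‖z i‖ = 1) → ∀ (a : ℕ → ℝ) (N : ℕ),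
    ‖∑ i ∈ Finset.range N, a i • z i‖ ≤
      C * ‖∑ i ∈ Finset.range N, a i • v (sInf (supp E.proj (z i)))‖

end FDD

/-- `D` is `d`-norming for `X`. -/
def IsNorming {X : Type*} [NormedAddCommGroup X] [NormedSpace ℝ X] (d : ℝ)
    (D : Set (StrongDual ℝ X)) : Prop :=
  ∀ z : X, d * ‖z‖ ≤ sSup ((fun f : StrongDual ℝ X => |f z|) '' D)

end BimonotoneFDD

end

namespace BimonotoneFDD

/-! ### Combinatorics of families of finite sets -/

/-- Families that are closed under subsets. -/
def IsHereditary (F : Set (Finset ℕ)) : Prop := ∀ A ∈ F, ∀ B, B ⊆ A → B ∈ F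

/-- There is no infinite set all of whose initial segments are members of the family. -/
def HasNoBranch (F : Set (Finset ℕ)) : Prop :=
  ∀ b : ℕ → ℕ, StrictMono b → ∃ k, (Finset.range k).image b ∉ F

/-- Families that are closed under moving elements to the right. -/
def IsSpreading (F : Set (Finset ℕ)) : Prop :=
  ∀ (W : Finset ℕ) (g h : ℕ → ℕ), StrictMonoOn g W → StrictMonoOn h W → (∀ w ∈ W, g w ≤ h w) →
    W.image g ∈ F → W.image h ∈ F

namespace IsRegular

variable {𝒜 : Set (Finset ℕ)}

theorem isHereditary (h : IsRegular 𝒜) : IsHereditary 𝒜 := h.hereditary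

theorem empty_mem (h : IsRegular 𝒜) : ∅ ∈ 𝒜 :=
  h.hereditary _ (h.singleton_mem 0) _ (Finset.empty_subset _)

/-- Enumerating `W` increasingly turns maps on `W` into sequences. Spreading in terms of maps on an
arbitrary finite set avoids `Fin`-indexed bookkeeping later. -/
theorem isSpreading (h : IsRegular 𝒜) : IsSpreading 𝒜 := by
  intro W g k hg hk hgk hW
  have key : ∀ u : ℕ → ℕ, W.image u = Finset.univ.image fun i : Fin W.card =>
      u (W.orderEmbOfFin rfl i) := by
    intro u
    ext x
    simp only [Finset.mem_image, Finset.mem_univ, true_and]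
    constructor
    · rintro ⟨w, hw, rfl⟩
      have : w ∈ Set.range (W.orderEmbOfFin rfl) := by
        rw [Finset.range_orderEmbOfFin]; exact hw
      obtain ⟨i, rfl⟩ := this
      exact ⟨i, rfl⟩
    · rintro ⟨i, rfl⟩
      exact ⟨_, Finset.orderEmbOfFin_mem _ _ _, rfl⟩
  rw [key] at hW ⊢
  have hm := fun i => Finset.orderEmbOfFin_mem W rfl i
  exact h.spreading _ _ _ (fun i j hij => hg (hm i) (hm j) ((W.orderEmbOfFin rfl).strictMono hij))
    (fun i j hij => hk (hm i) (hm j) ((W.orderEmbOfFin rfl).strictMono hij))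
    (fun i => hgk _ (hm i)) hW

/-- The indicators of the initial segments of a branch converge to the indicator of an infinite set,
which a compact set of indicators of finite sets cannot contain. -/
theorem hasNoBranch (h : IsRegular 𝒜) : HasNoBranch 𝒜 := by
  classical
  intro b hb
  by_contra! hcon
  have hlim : Tendsto (fun k => indicator ((Finset.range k).image b)) atTop
      (𝓝 fun n => decide (n ∈ Set.range b)) := by
    refine tendsto_pi_nhds.2 fun n => ?_
    refine tendsto_const_nhds.congr' ?_
    filter_upwards [eventually_gt_atTop n] with k hk
    simp only [indicator, Set.mem_range, Finset.mem_image, Finset.mem_range]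
    congr 1
    refine propext ⟨?_, ?_⟩
    · rintro ⟨i, rfl⟩
      exact ⟨i, (hb.id_le i).trans_lt hk, rfl⟩
    · rintro ⟨i, -, rfl⟩
      exact ⟨i, rfl⟩
  obtain ⟨A, -, hA⟩ := h.compact.isClosed.mem_of_tendsto hlim
    (Eventually.of_forall fun k => ⟨_, hcon k, rfl⟩)
  have hmem : ∀ i, b i ∈ A := fun i => by
    have := congrFun hA (b i)
    simpa [indicator] using this
  exact (Set.infinite_range_of_injective hb.injective)
    ((Finset.finite_toSet A).subset (by rintro _ ⟨i, rfl⟩; exact hmem i))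

end IsRegular

/-- Hereditary families without infinite branches are compact. -/
theorem isCompact_of_hasNoBranch {F : Set (Finset ℕ)} (hF : IsHereditary F) (hb : HasNoBranch F) :
    IsCompact (indicator '' F) := by
  refine IsClosed.isCompact (isClosed_of_closure_subset fun g hg => ?_)
  -- A closure point agrees on `S` with the indicator of a member, so heredity applies. If `g` had
  -- infinitely many ones, their increasing enumeration would then be a branch.
  have happ : ∀ S : Finset ℕ, (∀ n ∈ S, g n = true) → S ∈ F := by
    intro S hS
    have hopen : IsOpen {u : ℕ → Bool | ∀ n ∈ S, u n = true} := by
      have : {u : ℕ → Bool | ∀ n ∈ S, u n = true} = ⋂ n ∈ S, (fun u : ℕ → Bool => u n) ⁻¹' {true} := by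
        ext; simp
      rw [this]
      exact isOpen_biInter_finset fun n _ => (isOpen_discrete _).preimage (continuous_apply n)
    obtain ⟨u, hu, A, hA, rfl⟩ := mem_closure_iff.1 hg _ hopen hS
    refine hF A hA S fun n hn => ?_
    simpa [indicator] using hu n hn
  by_cases hfin : {n | g n = true}.Finite
  · refine ⟨hfin.toFinset, happ _ (by simp), ?_⟩
    funext n
    by_cases h : g n = true <;> simp [indicator, h]
  · exfalso
    obtain ⟨k, hk⟩ := hb _ (Nat.nth_strictMono (p := fun n => g n = true) hfin)
    refine hk (happ _ fun n hn => ?_)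
    obtain ⟨i, -, rfl⟩ := Finset.mem_image.1 hn
    exact Nat.nth_mem_of_infinite (p := fun n => g n = true) hfin i

/-! ### Regular hulls and induction along trees -/

/-- The family of all sets with at most one element and all spreads of subsets of members. -/
def spreadClosure (𝓑 : Set (Finset ℕ)) : Set (Finset ℕ) :=
  {A | A.card ≤ 1 ∨ ∃ B ∈ 𝓑, ∃ g : ℕ → ℕ, StrictMonoOn g A ∧ (∀ a ∈ A, g a ≤ a) ∧ A.image g ⊆ B}

theorem subset_spreadClosure (𝓑 : Set (Finset ℕ)) : 𝓑 ⊆ spreadClosure 𝓑 := fun B hB =>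
  Or.inr ⟨B, hB, id, fun _ _ _ _ h => h, fun _ _ => le_rfl, by simp⟩

/-- A pointwise bounded sequence of functions agrees on every initial segment infinitely often with
one fixed function. -/
theorem exists_frequently_eq (g : ℕ → ℕ → ℕ) (M : ℕ → ℕ)
    (hg : ∀ i, ∀ᶠ k in atTop, g k i ≤ M i) :
    ∃ u : ℕ → ℕ, ∀ n, ∃ᶠ k in atTop, ∀ i < n, g k i = u i := by
  -- Along a free ultrafilter each coordinate, having finitely many possible values, is eventually
  -- constant. This replaces a diagonal choice of subsequences.
  let U : Ultrafilter ℕ := hyperfilter ℕ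
  have hU : (U : Filter ℕ) ≤ atTop := by
    rw [← Nat.cofinite_eq_atTop]; exact hyperfilter_le_cofinite
  have h : ∀ i, ∃ v, ∀ᶠ k in (U : Filter ℕ), g k i = v := by
    intro i
    have h1 : ∀ᶠ k in (U : Filter ℕ), ∃ v ∈ Set.Iic (M i), g k i = v := by
      filter_upwards [hU (hg i)] with k hk
      exact ⟨_, hk, rfl⟩
    obtain ⟨v, -, hv⟩ := (Ultrafilter.eventually_exists_mem_iff (Set.finite_Iic (M i))).1 h1
    exact ⟨v, hv⟩
  choose u hu using h
  refine ⟨u, fun n => ?_⟩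
  have : ∀ᶠ k in (U : Filter ℕ), ∀ i ∈ Set.Iio n, g k i = u i :=
    (eventually_all_finite (Set.finite_Iio n)).2 fun i _ => hu i
  exact (this.frequently).filter_mono hU

/-- A collection of finite sets whose hereditary closure has no infinite branch is contained in a
regular family. -/
theorem exists_isRegular_superset (𝓑 : Set (Finset ℕ))
    (h : ∀ b : ℕ → ℕ, StrictMono b → ∃ k, ∀ B ∈ 𝓑, ¬ (Finset.range k).image b ⊆ B) :
    ∃ 𝒜, IsRegular 𝒜 ∧ 𝓑 ⊆ 𝒜 := by
  have hher : IsHereditary (spreadClosure 𝓑) := by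
    rintro A (hA | ⟨B, hB, g, hg, hga, hgB⟩) A' hA'
    · exact Or.inl ((Finset.card_le_card hA').trans hA)
    · exact Or.inr ⟨B, hB, g, hg.mono (by exact_mod_cast hA'), fun a ha => hga a (hA' ha),
        (Finset.image_subset_image hA').trans hgB⟩
  refine ⟨spreadClosure 𝓑, ⟨fun n => Or.inl (by simp), isCompact_of_hasNoBranch hher ?_, hher, ?_⟩,
    subset_spreadClosure 𝓑⟩
  · intro b hb
    by_contra! hcon
    -- A branch `b` of the spread closure is pulled back, segment by segment, to increasing finite
    -- sequences below `b` inside members of `𝓑`. The condition `2 ≤ k` rules out the sets of at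
    -- most one element that were added by hand.
    have hg : ∀ k, ∃ g : ℕ → ℕ, 2 ≤ k → ∃ B ∈ 𝓑, (∀ i j, i < j → j < k → g i < g j) ∧
        (∀ i < k, g i ≤ b i) ∧ ∀ i < k, g i ∈ B := by
      intro k
      rcases hcon k with hk | ⟨B, hB, g, hg, hga, hgB⟩
      · refine ⟨id, fun h2 => ?_⟩
        rw [Finset.card_image_of_injective _ hb.injective, Finset.card_range] at hk
        omega
      · have hmem : ∀ i < k, b i ∈ (Finset.range k).image b := fun i hi =>
          Finset.mem_image_of_mem _ (Finset.mem_range.2 hi)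
        refine ⟨g ∘ b, fun _ => ⟨B, hB, fun i j hij hj => ?_, fun i hi => hga _ (hmem i hi),
          fun i hi => hgB (Finset.mem_image_of_mem _ (hmem i hi))⟩⟩
        exact hg (hmem i (hij.trans hj)) (hmem j hj) (hb hij)
    choose g hg using hg
    -- The pulled-back sequences are dominated by `b`, so they have a pointwise cluster point `u`,
    -- which is a branch forbidden by `h`.
    obtain ⟨u, hu⟩ := exists_frequently_eq g b fun i => by
      filter_upwards [eventually_ge_atTop (i + 2)] with k hk
      obtain ⟨B, -, -, h2, -⟩ := hg k (by omega)
      exact h2 i (by omega)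
    have hu' : ∀ n, ∃ k, n + 2 ≤ k ∧ ∀ i < n, g k i = u i := fun n => by
      obtain ⟨k, h1, h2⟩ := ((hu n).and_eventually (eventually_ge_atTop (n + 2))).exists
      exact ⟨k, h2, h1⟩
    have humono : StrictMono u := by
      refine strictMono_nat_of_lt_succ fun n => ?_
      obtain ⟨k, hk, hk'⟩ := hu' (n + 2)
      obtain ⟨B, -, h1, -⟩ := hg k (by omega)
      rw [← hk' n (by omega), ← hk' (n + 1) (by omega)]
      exact h1 _ _ (by omega) (by omega)
    obtain ⟨n, hn⟩ := h u humono
    obtain ⟨k, hk, hk'⟩ := hu' n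
    obtain ⟨B, hB, -, -, h3⟩ := hg k (by omega)
    refine hn B hB fun x hx => ?_
    obtain ⟨i, hi, rfl⟩ := Finset.mem_image.1 hx
    rw [Finset.mem_range] at hi
    rw [← hk' i hi]
    exact h3 i (by omega)
  · rintro n a b ha hb hab (hA | ⟨B, hB, g, hg, hga, hgB⟩)
    · refine Or.inl ?_
      rwa [Finset.card_image_of_injective _ hb.injective,
        ← Finset.card_image_of_injective _ ha.injective]
    · have hmem : ∀ i, a i ∈ Finset.univ.image a := fun i =>
        Finset.mem_image_of_mem _ (Finset.mem_univ i)
      -- The map sending `b i` back to `a i` moves points to the left, so composing it with `g`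
      -- shows the new set to be a spread of the same subset of `B`.
      have hinv : ∀ i, Function.extend b a id (b i) = a i := fun i => hb.injective.extend_apply _ _ i
      refine Or.inr ⟨B, hB, g ∘ Function.extend b a id, ?_, ?_, ?_⟩
      · intro x hx y hy hxy
        simp only [Finset.coe_image, Finset.coe_univ, Set.image_univ, Set.mem_range] at hx hy
        obtain ⟨i, rfl⟩ := hx
        obtain ⟨j, rfl⟩ := hy
        simp only [Function.comp, hinv]
        exact hg (hmem i) (hmem j) (ha (hb.lt_iff_lt.1 hxy))
      · intro x hx
        obtain ⟨i, -, rfl⟩ := Finset.mem_image.1 hx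
        simp only [Function.comp, hinv]
        exact (hga _ (hmem i)).trans (hab i)
      · intro x hx
        obtain ⟨y, hy, rfl⟩ := Finset.mem_image.1 hx
        obtain ⟨i, -, rfl⟩ := Finset.mem_image.1 hy
        simp only [Function.comp, hinv]
        exact hgB (Finset.mem_image_of_mem _ (hmem i))

/-- Induction along the tree of end extensions of a hereditary family without infinite branches. -/
theorem tree_induction {F : Set (Finset ℕ)} (hF : IsHereditary F) (hb : HasNoBranch F)
    {Q : Finset ℕ → Prop}
    (h : ∀ s ∈ F, (∀ n, (∀ a ∈ s, a < n) → insert n s ∈ F → Q (insert n s)) → Q s) :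
    ∀ s ∈ F, Q s := by
  by_contra! hcon
  obtain ⟨s₀, hs₀, hQ₀⟩ := hcon
  -- A failing node has a failing end extension; iterating, the added elements form an infinite
  -- branch.
  have step : ∀ s : {s // s ∈ F ∧ ¬ Q s}, ∃ n, (∀ a ∈ s.1, a < n) ∧
      insert n s.1 ∈ F ∧ ¬ Q (insert n s.1) := by
    rintro ⟨s, hs, hQ⟩
    by_contra! hc
    exact hQ (h s hs hc)
  choose n hn hnF hnQ using step
  let S : ℕ → {s // s ∈ F ∧ ¬ Q s} := fun k =>
    Nat.rec ⟨s₀, hs₀, hQ₀⟩ (fun _ s => ⟨insert (n s) s.1, hnF s, hnQ s⟩) k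
  have hS : ∀ k, (S (k + 1)).1 = insert (n (S k)) (S k).1 := fun _ => rfl
  have hmono : StrictMono fun k => n (S k) :=
    strictMono_nat_of_lt_succ fun k => hn (S (k + 1)) _ (by rw [hS]; exact Finset.mem_insert_self _ _)
  obtain ⟨k, hk⟩ := hb _ hmono
  refine hk (hF _ (S k).2.1 _ ?_)
  clear hk
  induction k with
  | zero => simp
  | succ k ih =>
    rw [hS, Finset.range_add_one, Finset.image_insert]
    exact Finset.insert_subset_insert _ ih

/-! ### Schreier families -/

section Schreier

variable {φ : Ordinal.{0} → ℕ → Ordinal.{0}} {α : Ordinal.{0}}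

theorem isSuccLimit_omega_one : Order.IsSuccLimit (ω₁ : Ordinal.{0}) := by
  rw [← Cardinal.ord_aleph]
  exact Cardinal.isSuccLimit_ord (Cardinal.aleph0_le_aleph 1)

/-- The sets that are unions of `n` successive members of `S` form the family `succUnion S n`. -/
def succUnion (S : Set (Finset ℕ)) : ℕ → Set (Finset ℕ)
  | 0 => {∅}
  | n + 1 => {A | ∃ B ∈ S, ∃ C ∈ succUnion S n, (∀ a ∈ B, ∀ b ∈ C, a < b) ∧ A = B ∪ C}

theorem biUnion_mem_succUnion {S : Set (Finset ℕ)} {n : ℕ} {B : Fin n → Finset ℕ}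
    (hB : ∀ i, B i ∈ S) (hlt : ∀ i j, i < j → ∀ a ∈ B i, ∀ b ∈ B j, a < b) :
    Finset.univ.biUnion B ∈ succUnion S n := by
  induction n with
  | zero => simp [succUnion]
  | succ n ih =>
    refine ⟨B 0, hB 0, _, ih (B := fun i => B i.succ) (fun i => hB _)
      (fun i j hij => hlt _ _ (Fin.succ_lt_succ_iff.2 hij)), ?_, ?_⟩
    · intro a ha b hb
      obtain ⟨i, -, hi⟩ := Finset.mem_biUnion.1 hb
      exact hlt 0 i.succ (Fin.succ_pos i) a ha b hi
    · ext x
      simp [Fin.exists_fin_succ]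

theorem isHereditary_succUnion {S : Set (Finset ℕ)} (hS : IsHereditary S) (n : ℕ) :
    IsHereditary (succUnion S n) := by
  induction n with
  | zero =>
    rintro A rfl B hB
    exact Finset.subset_empty.1 hB
  | succ n ih =>
    rintro _ ⟨B, hB, C, hC, hlt, rfl⟩ A hA
    refine ⟨A ∩ B, hS _ hB _ Finset.inter_subset_right, A ∩ C, ih _ hC _ Finset.inter_subset_right,
      fun a ha b hb => hlt a (Finset.mem_inter.1 ha).2 b (Finset.mem_inter.1 hb).2, ?_⟩
    rw [← Finset.inter_union_distrib_left, Finset.inter_eq_left.2 hA]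

/-- The first `k` elements of a branch are too many for the first piece `B`, so one of them already
lies in `C`. As `B` precedes `C`, everything from index `k` on lies in `C`, and the induction
hypothesis limits how long that can last. -/
theorem hasNoBranch_succUnion {S : Set (Finset ℕ)} (hS : IsHereditary S) (hb : HasNoBranch S)
    (n : ℕ) : HasNoBranch (succUnion S n) := by
  induction n with
  | zero => exact fun b _ => ⟨1, by simp [succUnion]⟩
  | succ n ih =>
    intro b hbm
    by_contra! hcon
    obtain ⟨k, hk⟩ := hb b hbm
    obtain ⟨l, hl⟩ := ih (fun i => b (k + i)) (hbm.comp (strictMono_id.const_add k))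
    obtain ⟨B, hB, C, hC, hlt, hBC⟩ := hcon (k + l)
    have hmem : ∀ i < k + l, b i ∈ B ∪ C := fun i hi => by
      rw [← hBC]; exact Finset.mem_image_of_mem _ (Finset.mem_range.2 hi)
    obtain ⟨x, hx, hxB⟩ := Finset.not_subset.1 fun h => hk (hS _ hB _ h)
    obtain ⟨i, hi, rfl⟩ := Finset.mem_image.1 hx
    rw [Finset.mem_range] at hi
    have hiC : b i ∈ C := (Finset.mem_union.1 (hmem i (by omega))).resolve_left hxB
    refine hl (isHereditary_succUnion hS n _ hC _ fun y hy => ?_)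
    obtain ⟨j, hj, rfl⟩ := Finset.mem_image.1 hy
    rw [Finset.mem_range] at hj
    refine (Finset.mem_union.1 (hmem (k + j) (by omega))).resolve_left fun hB' => ?_
    exact absurd (hlt _ hB' _ hiC) (not_lt.2 (hbm.monotone (by omega)))

theorem schreier_zero : schreier φ 0 = {A | A.card ≤ 1} := by
  rw [schreier, Ordinal.limitRecOn_zero]

theorem mem_schreier_succ {A : Finset ℕ} : A ∈ schreier φ (α + 1) ↔
    ∃ (n : ℕ) (B : Fin n → Finset ℕ), (∀ i, B i ∈ schreier φ α) ∧
      (∀ i j, i < j → ∀ a ∈ B i, ∀ b ∈ B j, a < b) ∧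
      A = Finset.univ.biUnion B ∧ ∀ a ∈ A, n ≤ a + 1 := by
  rw [schreier, Ordinal.limitRecOn_add_one]
  rfl

theorem mem_schreier_limit (hα : Order.IsSuccLimit α) {A : Finset ℕ} : A ∈ schreier φ α ↔
    ∃ n, φ α n < α ∧ A ∈ schreier φ (φ α n) ∧ ∀ a ∈ A, n ≤ a := by
  rw [schreier, Ordinal.limitRecOn_limit _ _ _ _ hα]
  constructor
  · rintro ⟨n, h, hA, hn⟩
    exact ⟨n, h, hA, fun a ha => Nat.le_of_succ_le_succ (hn a ha)⟩
  · rintro ⟨n, h, hA, hn⟩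
    exact ⟨n, h, hA, fun a ha => Nat.succ_le_succ (hn a ha)⟩

theorem isHereditary_schreier : IsHereditary (schreier φ α) := by
  induction α using Ordinal.limitRecOn with
  | zero =>
    rw [schreier_zero]
    exact fun A hA B hB => (Finset.card_le_card hB).trans hA
  | add_one α ih =>
    intro A hA A' hA'
    obtain ⟨n, B, hB, hlt, rfl, hn⟩ := mem_schreier_succ.1 hA
    refine mem_schreier_succ.2 ⟨n, fun i => A' ∩ B i, fun i => ih _ (hB i) _ Finset.inter_subset_right,
      fun i j hij a ha b hb => hlt i j hij a (Finset.mem_inter.1 ha).2 b (Finset.mem_inter.1 hb).2,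
      ?_, fun a ha => hn a (hA' ha)⟩
    ext x
    have := @hA' x
    simp only [Finset.mem_biUnion, Finset.mem_univ, true_and, Finset.mem_inter] at this ⊢
    exact ⟨fun h => (this h).imp fun i hi => ⟨h, hi⟩, fun ⟨i, h, _⟩ => h⟩
  | limit α hα ih =>
    intro A hA A' hA'
    obtain ⟨n, hlt, hA, hn⟩ := (mem_schreier_limit hα).1 hA
    exact (mem_schreier_limit hα).2 ⟨n, hlt, ih _ hlt _ hA _ hA', fun a ha => hn a (hA' ha)⟩

theorem isSpreading_schreier : IsSpreading (schreier φ α) := by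
  induction α using Ordinal.limitRecOn with
  | zero =>
    rw [schreier_zero]
    intro W g h hg hh _ hW
    change _ ≤ 1 at hW ⊢
    rwa [Finset.card_image_of_injOn hh.injOn, ← Finset.card_image_of_injOn hg.injOn]
  | add_one α ih =>
    intro W g h hg hh hgh hW
    obtain ⟨n, B, hB, hlt, hU, hn⟩ := mem_schreier_succ.1 hW
    have hsub : ∀ i, (W.filter fun w => g w ∈ B i) ⊆ W := fun i => Finset.filter_subset _ _
    -- The partition of the `g`-image is transported to the `h`-image. The bound on the number of
    -- pieces persists because `h` only increases the elements.
    refine mem_schreier_succ.2 ⟨n, fun i => (W.filter fun w => g w ∈ B i).image h, fun i => ?_, ?_, ?_,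
      ?_⟩
    · refine ih _ g h (hg.mono (by exact_mod_cast hsub i)) (hh.mono (by exact_mod_cast hsub i))
        (fun w hw => hgh w (hsub i hw)) ?_
      refine isHereditary_schreier _ (hB i) _ fun x hx => ?_
      obtain ⟨w, hw, rfl⟩ := Finset.mem_image.1 hx
      exact (Finset.mem_filter.1 hw).2
    · intro i j hij a ha b hb
      obtain ⟨v, hv, rfl⟩ := Finset.mem_image.1 ha
      obtain ⟨w, hw, rfl⟩ := Finset.mem_image.1 hb
      rw [Finset.mem_filter] at hv hw
      exact hh hv.1 hw.1 ((hg.lt_iff_lt hv.1 hw.1).1 (hlt i j hij _ hv.2 _ hw.2))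
    · ext x
      simp only [Finset.mem_image, Finset.mem_biUnion, Finset.mem_univ, true_and, Finset.mem_filter]
      constructor
      · rintro ⟨w, hw, rfl⟩
        have : g w ∈ Finset.univ.biUnion B := hU ▸ Finset.mem_image_of_mem g hw
        obtain ⟨i, -, hi⟩ := Finset.mem_biUnion.1 this
        exact ⟨i, w, ⟨hw, hi⟩, rfl⟩
      · rintro ⟨i, w, ⟨hw, -⟩, rfl⟩
        exact ⟨w, hw, rfl⟩
    · intro a ha
      obtain ⟨w, hw, rfl⟩ := Finset.mem_image.1 ha
      exact (hn _ (Finset.mem_image_of_mem g hw)).trans (Nat.succ_le_succ (hgh w hw))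
  | limit α hα ih =>
    intro W g h hg hh hgh hW
    obtain ⟨n, hlt, hA, hn⟩ := (mem_schreier_limit hα).1 hW
    refine (mem_schreier_limit hα).2 ⟨n, hlt, ih _ hlt _ g h hg hh hgh hA, fun a ha => ?_⟩
    obtain ⟨w, hw, rfl⟩ := Finset.mem_image.1 ha
    exact (hn _ (Finset.mem_image_of_mem g hw)).trans (hgh w hw)

theorem singleton_mem_schreier (hφ : IsFundamental φ) (hα : α < ω₁) (a : ℕ) :
    {a} ∈ schreier φ α := by
  induction α using Ordinal.limitRecOn with
  | zero => simp [schreier_zero]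
  | add_one α ih =>
    refine mem_schreier_succ.2 ⟨1, fun _ => {a}, fun _ => ih ((lt_add_one α).trans hα), ?_, ?_, ?_⟩
    · intro i j hij
      exact absurd hij (by simp [Subsingleton.elim i j])
    · simp
    · simp
  | limit α hl ih =>
    have h0 := (hφ α hα hl).2.1 0
    exact (mem_schreier_limit hl).2 ⟨0, h0, ih _ h0 (h0.trans hα), by simp⟩

theorem empty_mem_schreier (hφ : IsFundamental φ) (hα : α < ω₁) : ∅ ∈ schreier φ α :=
  isHereditary_schreier _ (singleton_mem_schreier hφ hα 0) _ (Finset.empty_subset _)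

theorem schreier_subset_succ :
    schreier φ α ⊆ schreier φ (α + 1) := by
  intro A hA
  refine mem_schreier_succ.2 ⟨1, fun _ => A, fun _ => hA, ?_, ?_, by simp⟩
  · intro i j hij
    exact absurd hij (by simp [Subsingleton.elim i j])
  · simp

/-- Two pieces `{a}` and `A` suffice. With the index shift two pieces require `2 ≤ a + 1`, which is
why the subsequences below are kept at values at least 1. -/
theorem insert_mem_schreier_succ (hφ : IsFundamental φ) (hα : α < ω₁) {A : Finset ℕ} {a : ℕ}
    (ha : 1 ≤ a) (hlt : ∀ b ∈ A, a < b) (hA : A ∈ schreier φ α) :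
    insert a A ∈ schreier φ (α + 1) := by
  refine mem_schreier_succ.2 ⟨2, ![{a}, A], ?_, ?_, ?_, ?_⟩
  · intro i
    fin_cases i
    · exact singleton_mem_schreier hφ hα a
    · exact hA
  · intro i j hij
    fin_cases i <;> fin_cases j <;> simp at hij ⊢
    exact hlt
  · ext x
    simp [Fin.exists_fin_two]
  · intro b hb
    rcases Finset.mem_insert.1 hb with rfl | hb
    · omega
    · have := hlt b hb
      omega

/-- Schreier families need not increase with the ordinal, but they do up to finitely many initial
integers: at a limit one passes to a member of the fundamental sequence above `α` and pays with a
lower bound on the minimum. -/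
theorem schreier_eventually_subset (hφ : IsFundamental φ) {β : Ordinal.{0}} (hβ : β < ω₁)
    (hαβ : α < β) : ∃ k, ∀ A ∈ schreier φ α, (∀ a ∈ A, k ≤ a) → A ∈ schreier φ β := by
  induction β using Ordinal.limitRecOn with
  | zero => exact absurd hαβ not_lt_zero
  | add_one β ih =>
    rcases (Order.lt_add_one_iff.1 hαβ).eq_or_lt with rfl | h
    · exact ⟨0, fun A hA _ => schreier_subset_succ hA⟩
    · obtain ⟨k, hk⟩ := ih ((lt_add_one β).trans hβ) h
      exact ⟨k, fun A hA h => schreier_subset_succ (hk A hA h)⟩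
  | limit β hl ih =>
    obtain ⟨n, hn⟩ := (hφ β hβ hl).2.2 α hαβ
    have hlt := (hφ β hβ hl).2.1 n
    obtain ⟨k, hk⟩ := ih _ hlt (hlt.trans hβ) hn
    exact ⟨max k n, fun A hA h => (mem_schreier_limit hl).2 ⟨n, hlt,
      hk A hA fun a ha => (le_max_left _ _).trans (h a ha),
      fun a ha => (le_max_right _ _).trans (h a ha)⟩⟩

/-- The first element of a branch bounds the parameter `n` in the definition of the family. Only
finitely many smaller families compete for the initial segments, and each eventually fails. -/
theorem hasNoBranch_schreier : HasNoBranch (schreier φ α) := by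
  induction α using Ordinal.limitRecOn with
  | zero =>
    intro b hb
    refine ⟨2, ?_⟩
    rw [schreier_zero]
    simp [Finset.card_image_of_injective _ hb.injective]
  | add_one α ih =>
    intro b hb
    by_contra! hcon
    have hk : ∀ n, ∃ k, (Finset.range k).image b ∉ succUnion (schreier φ α) n := fun n =>
      hasNoBranch_succUnion isHereditary_schreier ih n b hb
    choose k hk using hk
    -- The parameter satisfies `n ≤ b 0 + 1`. The final `+ 1` ensures that `b 0` itself belongs to
    -- the segment, so that this bound is available.
    let K := (Finset.range (b 0 + 2)).sup k + 1
    obtain ⟨n, B, hB, hlt, hU, hn⟩ := mem_schreier_succ.1 (hcon K)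
    have hn0 := hn (b 0) (Finset.mem_image_of_mem _ (Finset.mem_range.2 (by omega)))
    refine hk n (isHereditary_succUnion isHereditary_schreier n _
      (hU ▸ biUnion_mem_succUnion hB hlt) _ (Finset.image_subset_image fun i hi => ?_))
    rw [Finset.mem_range] at hi ⊢
    have := Finset.le_sup (f := k) (Finset.mem_range.2 (show n < b 0 + 2 by omega))
    omega
  | limit α hl ih =>
    intro b hb
    by_contra! hcon
    have hk : ∀ n, ∃ k, φ α n < α → (Finset.range k).image b ∉ schreier φ (φ α n) := fun n => by
      by_cases hn : φ α n < α
      · exact (ih _ hn b hb).imp fun k hk _ => hk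
      · exact ⟨0, fun h => absurd h hn⟩
    choose k hk using hk
    let K := (Finset.range (b 0 + 1)).sup k + 1
    obtain ⟨n, hlt, hA, hn⟩ := (mem_schreier_limit hl).1 (hcon K)
    have hn0 := hn (b 0) (Finset.mem_image_of_mem _ (Finset.mem_range.2 (by omega)))
    refine hk n hlt (isHereditary_schreier _ hA _ (Finset.image_subset_image fun i hi => ?_))
    rw [Finset.mem_range] at hi ⊢
    have := Finset.le_sup (f := k) (Finset.mem_range.2 (show n < b 0 + 1 by omega))
    omega

/-- Every hereditary family without infinite branches embeds into a Schreier family along a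
subsequence. -/
theorem exists_image_mem_schreier (hφ : IsFundamental φ) {F : Set (Finset ℕ)} (hF : IsHereditary F)
    (hb : HasNoBranch F) (h0 : ∅ ∈ F) :
    ∃ α < ω₁, ∃ m : ℕ → ℕ, StrictMono m ∧ (∀ i, 1 ≤ m i) ∧ ∀ A ∈ F, A.image m ∈ schreier φ α := by
  -- The statement is strengthened to the tails of all nodes `s`. Each child `insert n s` comes with
  -- its own ordinal and subsequence, and these must be merged.
  have key := tree_induction hF hb (Q := fun s => ∃ α < ω₁, ∃ m : ℕ → ℕ, StrictMono m ∧
    (∀ i, 1 ≤ m i) ∧ ∀ B : Finset ℕ, (∀ a ∈ s, ∀ b ∈ B, a < b) → s ∪ B ∈ F →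
      B.image m ∈ schreier φ α) ?_ ∅ h0
  · simpa using key
  intro s hs ih
  have ih' : ∀ n, ∃ α, ∃ m : ℕ → ℕ, α < ω₁ ∧ StrictMono m ∧
      ((∀ a ∈ s, a < n) → insert n s ∈ F → ∀ B : Finset ℕ, (∀ a ∈ insert n s, ∀ b ∈ B, a < b) →
        insert n s ∪ B ∈ F → B.image m ∈ schreier φ α) := by
    intro n
    by_cases h : (∀ a ∈ s, a < n) ∧ insert n s ∈ F
    · obtain ⟨α, hα, m, hm, -, h'⟩ := ih n h.1 h.2
      exact ⟨α, m, hα, hm, fun _ _ => h'⟩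
    · exact ⟨0, id, Ordinal.omega_pos 1, strictMono_id, fun h1 h2 => absurd ⟨h1, h2⟩ h⟩
  choose α m hα hm hαm using ih'
  let β : Ordinal.{0} := (⨆ n, α n) + 1
  have hβ : β < ω₁ := isSuccLimit_omega_one.add_one_lt (Ordinal.iSup_lt_omega_one hα)
  have hαβ : ∀ n, α n < β := fun n => Order.lt_add_one_iff.2 (Ordinal.le_iSup α n)
  choose K hK using fun n => schreier_eventually_subset hφ hβ (hαβ n)
  -- Diagonal subsequence: for `n ≤ k` it dominates `m n k`, so spreading transfers membership from
  -- `m n` to `M`, and it exceeds `K n`, past which `S_{α n}` is contained in `S_β`. The sum makes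
  -- it strictly increasing.
  let M : ℕ → ℕ := fun k => ∑ n ∈ Finset.range (k + 1), (m n k + K n) + 1
  have hM : ∀ n k, n ≤ k → m n k + K n ≤ M k := fun n k hnk =>
    (Finset.single_le_sum (f := fun n => m n k + K n) (fun _ _ => Nat.zero_le _)
      (Finset.mem_range.2 (by omega : n < k + 1))).trans (Nat.le_succ _)
  have hMmono : StrictMono M := by
    refine strictMono_nat_of_lt_succ fun k => Nat.succ_lt_succ ?_
    calc ∑ n ∈ Finset.range (k + 1), (m n k + K n)
        < ∑ n ∈ Finset.range (k + 1), (m n (k + 1) + K n) :=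
          Finset.sum_lt_sum_of_nonempty (by simp) fun n _ =>
            Nat.add_lt_add_right (hm n (Nat.lt_succ_self k)) _
      _ ≤ _ := by
          rw [Finset.sum_range_succ _ (k + 1)]
          exact Nat.le_add_right _ _
  refine ⟨β + 1, isSuccLimit_omega_one.add_one_lt hβ, M, hMmono, fun i => Nat.le_add_left _ _, fun B hsB hB => ?_⟩
  rcases B.eq_empty_or_nonempty with rfl | hne
  · simpa using empty_mem_schreier hφ (isSuccLimit_omega_one.add_one_lt hβ)
  -- The minimum of `B` selects the child. The rest of `B` is handled by that child, and putting the
  -- minimum back costs one successor step.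
  set n := B.min' hne with hn
  have hnB : n ∈ B := B.min'_mem hne
  have hlt : ∀ b ∈ B.erase n, n < b := fun b hb => B.min'_lt_of_mem_erase_min' hne hb
  have hins : insert n s ∪ B.erase n = s ∪ B := by
    ext x
    by_cases hx : x = n <;> simp [hx, hnB]
  have h1 : (B.erase n).image (m n) ∈ schreier φ (α n) := by
    refine hαm n (fun a ha => hsB a ha n hnB) (hF _ hB _ ?_) _ ?_ (by rwa [hins])
    · exact hins ▸ Finset.subset_union_left
    · intro a ha b hb
      rcases Finset.mem_insert.1 ha with rfl | ha
      · exact hlt b hb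
      · exact hsB a ha b (Finset.mem_of_mem_erase hb)
  have h2 : (B.erase n).image M ∈ schreier φ (α n) :=
    isSpreading_schreier _ _ _ ((hm n).strictMonoOn _) (hMmono.strictMonoOn _)
      (fun b hb => (Nat.le_add_right _ _).trans (hM n b (hlt b hb).le)) h1
  have h3 : (B.erase n).image M ∈ schreier φ β := by
    refine hK n _ h2 fun a ha => ?_
    obtain ⟨b, hb, rfl⟩ := Finset.mem_image.1 ha
    exact (Nat.le_add_left _ _).trans (hM n b (hlt b hb).le)
  rw [← Finset.insert_erase hnB, Finset.image_insert]
  refine insert_mem_schreier_succ hφ hβ (Nat.le_add_left _ _) (fun b hb => ?_) h3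
  obtain ⟨c, hc, rfl⟩ := Finset.mem_image.1 hb
  exact hMmono (hlt c hc)

end Schreier

/-! ### Convex combinations with small Tsirelson norm -/

/-- Decreasing sequences of non-empty convex subsets of the unit ball of `ℓ₁` whose supports tend to
infinity. -/
structure IsConvexTail (K : ℕ → Set (ℕ →₀ ℝ)) : Prop where
  convex : ∀ n, Convex ℝ (K n)
  nonempty : ∀ n, (K n).Nonempty
  anti : Antitone K
  le_one : ∀ n, ∀ b ∈ K n, sumAbs b ≤ 1
  eq_zero : ∀ n, ∀ b ∈ K n, ∀ i < n, b i = 0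

/-- Functions that take small values on all sequences of convex sets as above. -/
def IsSmall (N : (ℕ →₀ ℝ) → ℝ) : Prop :=
  ∀ K, IsConvexTail K → ∀ ε : ℝ, 0 < ε → ∃ b ∈ K 0, N b ≤ ε

/-- Functions that do not increase under restrictions to finite sets. -/
def IsRestrictionMonotone (N : (ℕ →₀ ℝ) → ℝ) : Prop :=
  ∀ (A : Finset ℕ) x, N (x.filter fun k => k ∈ A) ≤ N x

theorem sumAbs_zero : sumAbs 0 = 0 := by simp [sumAbs]

theorem sumAbs_nonneg (x : ℕ →₀ ℝ) : 0 ≤ sumAbs x := Finset.sum_nonneg fun _ _ => abs_nonneg _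

namespace IsGood

variable {N : (ℕ →₀ ℝ) → ℝ}

theorem map_zero (hN : IsGood N) : N 0 = 0 :=
  le_antisymm ((hN.le 0).trans_eq sumAbs_zero) (hN.nonneg 0)

theorem sum_le (hN : IsGood N) {ι : Type*} (s : Finset ι) (x : ι → ℕ →₀ ℝ) :
    N (∑ i ∈ s, x i) ≤ ∑ i ∈ s, N (x i) := by
  classical
  induction s using Finset.induction_on with
  | empty => simp [hN.map_zero]
  | insert i s hi ih =>
    rw [Finset.sum_insert hi, Finset.sum_insert hi]
    exact (hN.add _ _).trans (add_le_add_right ih _)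

theorem convex_le (hN : IsGood N) (ε : ℝ) : Convex ℝ {b | N b ≤ ε} := by
  intro x hx y hy a b ha hb hab
  calc N (a • x + b • y) ≤ |a| * N x + |b| * N y :=
        (hN.add _ _).trans (add_le_add (hN.smul _ _) (hN.smul _ _))
    _ ≤ |a| * ε + |b| * ε := by gcongr <;> assumption
    _ = ε := by rw [abs_of_nonneg ha, abs_of_nonneg hb, ← add_mul, hab, one_mul]

end IsGood

theorem isGood_abs_apply (i : ℕ) : IsGood fun x => |x i| :=
  ⟨fun _ => abs_nonneg _, fun x => abs_le_sumAbs x i, fun _ _ => abs_add_le _ _,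
    fun _ _ => (abs_mul _ _).le⟩

variable {𝒜 F : Set (Finset ℕ)} {c : ℝ} {N : (ℕ →₀ ℝ) → ℝ} {K : ℕ → Set (ℕ →₀ ℝ)}

theorem isGood_admissibleSum (hc : c ∈ Set.Ioo (0 : ℝ) 1) (hN : IsGood N) {n : ℕ}
    {A : Fin n → Finset ℕ} (hA : IsAdmissible 𝒜 fun i => (A i : Set ℕ)) :
    IsGood fun x => ∑ i, c * N (x.filter fun k => k ∈ A i) := by
  refine ⟨fun x => Finset.sum_nonneg fun i _ => mul_nonneg hc.1.le (hN.nonneg _), fun x => ?_,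
    fun x y => ?_, fun a x => ?_⟩
  · exact (hN.mem_bounds hc ⟨n, A, hA, rfl⟩).2
  · rw [← Finset.sum_add_distrib]
    refine Finset.sum_le_sum fun i _ => ?_
    rw [← mul_add, Finsupp.filter_add]
    exact mul_le_mul_of_nonneg_left (hN.add _ _) hc.1.le
  · rw [Finset.mul_sum]
    refine Finset.sum_le_sum fun i _ => ?_
    rw [mul_left_comm, Finsupp.filter_smul]
    exact mul_le_mul_of_nonneg_left (hN.smul _ _) hc.1.le

theorem IsConvexTail.shift (hK : IsConvexTail K) (m : ℕ) : IsConvexTail fun n => K (m + n) :=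
  ⟨fun n => hK.convex _, fun n => hK.nonempty _, fun _ _ hij => hK.anti (by omega),
    fun n => hK.le_one _, fun n b hb i hi => hK.eq_zero _ b hb i (by omega)⟩

/-- Smallness applies to every shift of the sequence, so the sublevel set meets each `K n`. This
allows several smallness conditions to be imposed one after another. -/
theorem IsConvexTail.inter (hK : IsConvexTail K) (hN : IsGood N) (hs : IsSmall N) {ε : ℝ}
    (hε : 0 < ε) : IsConvexTail fun n => K n ∩ {b | N b ≤ ε} :=
  ⟨fun n => (hK.convex n).inter (hN.convex_le ε), fun n => hs _ (hK.shift n) ε hε,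
    fun _ _ hij => Set.inter_subset_inter_left _ (hK.anti hij), fun n b hb => hK.le_one n b hb.1,
    fun n b hb => hK.eq_zero n b hb.1⟩

theorem IsConvexTail.exists_forall_le {ι : Type*} (s : Finset ι) {M : ι → (ℕ →₀ ℝ) → ℝ}
    (hM : ∀ j ∈ s, IsGood (M j) ∧ IsSmall (M j)) {ε : ℝ} (hε : 0 < ε) (hK : IsConvexTail K) :
    ∃ b ∈ K 0, ∀ j ∈ s, M j b ≤ ε := by
  classical
  induction s using Finset.induction_on generalizing K with
  | empty => exact (hK.nonempty 0).imp fun b hb => ⟨hb, by simp⟩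
  | insert i s hi ih =>
    have h := hM i (Finset.mem_insert_self _ _)
    obtain ⟨b, hb, hbs⟩ := ih (fun j hj => hM j (Finset.mem_insert_of_mem hj))
      (hK.inter h.1 h.2 hε)
    refine ⟨b, hb.1, fun j hj => ?_⟩
    rcases Finset.mem_insert.1 hj with rfl | hj
    · exact hb.2
    · exact hbs j hj

/-- Averages of successive vectors. -/
theorem IsConvexTail.exists_average (hK : IsConvexTail K) {R : ℕ → (ℕ →₀ ℝ) → Prop}
    (h : ∀ n, ∃ b ∈ K n, R n b) {ε : ℝ} (hε : 0 < ε) :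
    ∃ y ∈ K 0, ∀ G, IsGood G → ∀ (a : ℕ) (η : ℝ), 0 ≤ η →
      (∀ n, ∀ b ∈ K n, a < n → R n b → G b ≤ η) → (∀ b, (∀ i ≥ a, b i = 0) → G b = 0) →
      G y ≤ ε + η := by
  choose β hβ hR using h
  -- Iterating `ν` from 0 yields cut points `n i` such that `β (n i)` is supported in `[n i, n
  -- (i+1))`. The average of `k + 1` of these vectors is fixed before `G`, `a` and `η`, so the
  -- estimate is uniform in them.
  let ν : ℕ → ℕ := fun n => max n ((β n).support.sup id + 1)
  have hν : ∀ n, ∀ i ≥ ν n, β n i = 0 := fun n i hi => by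
    by_contra hne
    have h1 : id i ≤ (β n).support.sup id := Finset.le_sup (Finsupp.mem_support_iff.2 hne)
    have h2 := le_max_right n ((β n).support.sup id + 1)
    simp only [ν, id] at hi h1
    omega
  let n : ℕ → ℕ := fun i => ν^[i] 0
  have hn : ∀ i, n (i + 1) = ν (n i) := fun i => Function.iterate_succ_apply' ν i 0
  have hmono : Monotone n := monotone_nat_of_le_succ fun i => by
    rw [hn]; exact le_max_left _ _
  obtain ⟨k, hk⟩ := exists_nat_one_div_lt hε
  have hk0 : (0 : ℝ) < k + 1 := by positivity
  refine ⟨∑ i ∈ Finset.range (k + 1), (1 / (k + 1) : ℝ) • β (n i), ?_, ?_⟩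
  · refine (hK.convex 0).sum_mem (fun _ _ => by positivity) ?_ fun i _ =>
      hK.anti (Nat.zero_le _) (hβ _)
    rw [Finset.sum_const, Finset.card_range, nsmul_eq_mul]
    push_cast
    field_simp
  · intro G hG a η hη h1 h0
    -- Blocks after `a` contribute at most `η`, blocks before `a` nothing. At most one block
    -- straddles `a`; it is bounded by its ℓ₁-norm and gets weight `1/(k+1) < ε` in the average.
    have key : ∀ i, G (β (n i)) ≤ η + if n i ≤ a ∧ a < n (i + 1) then 1 else 0 := by
      intro i
      by_cases hi : a < n i
      · exact (h1 _ _ (hβ _) hi (hR _)).trans (le_add_of_nonneg_right (by split_ifs <;> norm_num))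
      · by_cases hi' : a < n (i + 1)
        · rw [if_pos ⟨not_lt.1 hi, hi'⟩]
          exact ((hG.le _).trans (hK.le_one _ _ (hβ _))).trans (le_add_of_nonneg_left hη)
        · rw [h0 _ fun j hj => hν _ j ?_, if_neg fun h => hi' h.2, add_zero]
          · exact hη
          · rw [← hn]; exact (not_lt.1 hi').trans hj
    have hcard : ∑ i ∈ Finset.range (k + 1), (if n i ≤ a ∧ a < n (i + 1) then (1 : ℝ) else 0) ≤ 1 := by
      rw [Finset.sum_boole]
      have : ((Finset.range (k + 1)).filter fun i => n i ≤ a ∧ a < n (i + 1)).card ≤ 1 := by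
        refine Finset.card_le_one.2 fun i hi j hj => ?_
        rw [Finset.mem_filter] at hi hj
        by_contra hne
        rcases lt_or_gt_of_ne hne with hij | hij
        · exact absurd (hmono (Nat.succ_le_of_lt hij)) (not_le.2 (hj.2.1.trans_lt hi.2.2))
        · exact absurd (hmono (Nat.succ_le_of_lt hij)) (not_le.2 (hi.2.1.trans_lt hj.2.2))
      exact_mod_cast this
    calc G (∑ i ∈ Finset.range (k + 1), (1 / (k + 1) : ℝ) • β (n i))
        ≤ ∑ i ∈ Finset.range (k + 1), (1 / (k + 1) : ℝ) *
            (η + if n i ≤ a ∧ a < n (i + 1) then 1 else 0) := by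
          refine (hG.sum_le _ _).trans (Finset.sum_le_sum fun i _ => (hG.smul _ _).trans ?_)
          rw [abs_of_nonneg (by positivity)]
          exact mul_le_mul_of_nonneg_left (key i) (by positivity)
      _ = η + (1 / (k + 1) : ℝ) *
            ∑ i ∈ Finset.range (k + 1), (if n i ≤ a ∧ a < n (i + 1) then (1 : ℝ) else 0) := by
          rw [← Finset.mul_sum, Finset.sum_add_distrib, Finset.sum_const, Finset.card_range,
            nsmul_eq_mul, mul_add]
          push_cast
          congr 1
          field_simp
      _ ≤ η + (1 / (k + 1) : ℝ) * 1 := by gcongr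
      _ ≤ ε + η := by linarith

/-- The end extensions of `s` in `F`. -/
def tailFamily (F : Set (Finset ℕ)) (s : Finset ℕ) : Set (Finset ℕ) :=
  {t | (∀ a ∈ s, ∀ b ∈ t, a < b) ∧ s ∪ t ∈ F}

theorem tailFamily_empty : tailFamily F ∅ = F := by
  ext t; simp [tailFamily]

/-- Splitting off the first set moves its minimum into the node, which is the recursion matching
tree induction. -/
theorem IsAdmissible.tail {s : Finset ℕ} (hF : IsHereditary F) {n : ℕ} {A : Fin (n + 1) → Set ℕ}
    (hA : IsAdmissible (tailFamily F s) A) :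
    (∀ b ∈ s, b < sInf (A 0)) ∧ insert (sInf (A 0)) s ∈ F ∧
      IsAdmissible (tailFamily F (insert (sInf (A 0)) s)) fun i : Fin n => A i.succ := by
  obtain ⟨hlt, hmem⟩ := hA.mins_mem
  have himage : (Finset.univ.image fun i => sInf (A i)) =
      insert (sInf (A 0)) (Finset.univ.image fun i : Fin n => sInf (A i.succ)) := by
    ext x; simp [Fin.exists_fin_succ, eq_comm]
  rw [himage] at hlt hmem
  refine ⟨fun b hb => hlt b hb _ (Finset.mem_insert_self _ _), hF _ hmem _ ?_,
    fun i => hA.nonempty _, fun i j hij => hA.lt _ _ (Fin.succ_lt_succ_iff.2 hij), ?_, ?_⟩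
  · intro x hx
    simp only [Finset.mem_insert, Finset.mem_union] at hx ⊢
    tauto
  · intro a ha b hb
    rcases Finset.mem_insert.1 ha with rfl | ha
    · obtain ⟨i, -, rfl⟩ := Finset.mem_image.1 hb
      exact hA.lt 0 i.succ (Fin.succ_pos i) _ (Nat.sInf_mem (hA.nonempty _)) _
        (Nat.sInf_mem (hA.nonempty _))
    · exact hlt a ha b (Finset.mem_insert_of_mem hb)
  · rwa [Finset.insert_union, ← Finset.union_insert]

/-- Tree induction on the node `s`. Once the first minimum `a` of an admissible sequence is known,
the remaining sets are admissible for the child `insert a s`. Far out vectors can be made small for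
the finitely many children below them, and averaging takes care of the dependence on `a`. -/
theorem isSmall_sSup_admissibleSums (hF : IsHereditary F) (hb : HasNoBranch F) (h0 : ∅ ∈ F)
    (hc : c ∈ Set.Ioo (0 : ℝ) 1) (hN : IsGood N) (hmono : IsRestrictionMonotone N)
    (hs : IsSmall N) : IsSmall fun x => sSup (admissibleSums F c N x) := by
  have key := tree_induction hF hb
    (Q := fun s => IsSmall fun x => sSup (admissibleSums (tailFamily F s) c N x)) ?_ ∅ h0
  · simpa only [tailFamily_empty] using key
  intro s _ ih K hK ε hε
  have hε3 : 0 < ε / 3 := by positivity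
  classical
  obtain ⟨y, hy, hyG⟩ := hK.exists_average (ε := ε / 3) (R := fun n b => N b ≤ ε / 3 ∧
      ∀ j < n, (∀ a ∈ s, a < j) → insert j s ∈ F →
        sSup (admissibleSums (tailFamily F (insert j s)) c N b) ≤ ε / 3) (fun n => by
    obtain ⟨b, hb, hbs⟩ := IsConvexTail.exists_forall_le
      ((Finset.range n).filter fun j => (∀ a ∈ s, a < j) ∧ insert j s ∈ F)
      (M := fun j x => sSup (admissibleSums (tailFamily F (insert j s)) c N x))
      (fun j hj => ⟨isGood_sSup hc hN, ih j (Finset.mem_filter.1 hj).2.1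
        (Finset.mem_filter.1 hj).2.2⟩) hε3 ((hK.inter hN hs hε3).shift n)
    exact ⟨b, hb.1, hb.2, fun j hj h1 h2 =>
      hbs j (Finset.mem_filter.2 ⟨Finset.mem_range.2 hj, h1, h2⟩)⟩) hε3
  refine ⟨y, hy, Real.sSup_le ?_ hε.le⟩
  rintro r ⟨n, A, hA, rfl⟩
  cases n with
  | zero => simpa using hε.le
  | succ n =>
    obtain ⟨h1, h2, h3⟩ := hA.tail hF
    -- A vector supported after the first minimum pays `ε / 3` for the first set and `ε / 3` for the
    -- rest, through the child; the straddling vector accounts for the last third.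
    refine (hyG _ (isGood_admissibleSum hc hN hA) (sInf (A 0 : Set ℕ)) (ε / 3 + ε / 3) (by positivity)
      (fun m b _ hm hR => ?_) fun b hb => ?_).trans (by linarith)
    · rw [Fin.sum_univ_succ]
      refine add_le_add ?_ ?_
      · exact (mul_le_of_le_one_left (hN.nonneg _) hc.2.le).trans ((hmono _ _).trans hR.1)
      · exact (le_csSup (hN.bddAbove hc b) ⟨n, _, h3, rfl⟩).trans (hR.2 _ hm h1 h2)
    · refine Finset.sum_eq_zero fun i _ => ?_
      have : (b.filter fun k => k ∈ A i) = 0 := by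
        refine Finsupp.filter_eq_zero_iff _ _ |>.2 fun k hk => hb k ?_
        rcases eq_or_ne i 0 with rfl | hi
        · exact Nat.sInf_le hk
        · exact (hA.lt 0 i (Fin.pos_of_ne_zero hi) _ (Nat.sInf_mem (hA.nonempty 0)) k hk).le
      rw [this, hN.map_zero, mul_zero]

theorem filter_filter_comm (x : ℕ →₀ ℝ) (A B : Finset ℕ) :
    (x.filter fun k => k ∈ A).filter (fun k => k ∈ B) =
      (x.filter fun k => k ∈ B).filter fun k => k ∈ A := by
  ext k
  by_cases hA : k ∈ A <;> by_cases hB : k ∈ B <;> simp [hA, hB]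

theorem isRestrictionMonotone_tsirelsonIter (hc : c ∈ Set.Ioo (0 : ℝ) 1) (k : ℕ) :
    IsRestrictionMonotone (tsirelsonIter F c k) := by
  induction k with
  | zero =>
    intro A x
    refine ciSup_le fun i => ?_
    refine le_trans ?_ (le_ciSup (f := fun i => |x i|)
      ⟨sumAbs x, by rintro _ ⟨k, rfl⟩; exact abs_le_sumAbs x k⟩ i)
    by_cases hi : i ∈ A <;> simp [hi]
  | succ k ih =>
    intro A x
    have hg := isGood_tsirelsonIter (𝒜 := F) hc k
    refine max_le_max (ih A x) (Real.sSup_le ?_ ((isGood_sSup hc hg).nonneg x))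
    rintro r ⟨n, B, hB, rfl⟩
    refine le_trans (Finset.sum_le_sum fun i _ => ?_) (le_csSup (hg.bddAbove hc x) ⟨n, B, hB, rfl⟩)
    rw [filter_filter_comm]
    exact mul_le_mul_of_nonneg_left (ih _ _) hc.1.le

theorem isRestrictionMonotone_tsirelsonNorm (hc : c ∈ Set.Ioo (0 : ℝ) 1) :
    IsRestrictionMonotone (tsirelsonNorm F c) := fun A x =>
  ciSup_le fun k => (isRestrictionMonotone_tsirelsonIter hc k A x).trans (tsirelsonIter_le hc k x)

theorem isSmall_tsirelsonIter (hF : IsHereditary F) (hb : HasNoBranch F) (h0 : ∅ ∈ F)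
    (hc : c ∈ Set.Ioo (0 : ℝ) 1) (k : ℕ) : IsSmall (tsirelsonIter F c k) := by
  induction k with
  | zero =>
    intro K hK ε hε
    obtain ⟨y, hy, h⟩ := hK.exists_average (R := fun _ _ => True)
      (fun n => (hK.nonempty n).imp fun b hb => ⟨hb, trivial⟩) hε
    refine ⟨y, hy, ciSup_le fun i => ?_⟩
    have := h _ (isGood_abs_apply i) i 0 le_rfl
      (fun n b hb hn _ => by rw [hK.eq_zero n b hb i hn, abs_zero])
      (fun b hb => by rw [hb i le_rfl, abs_zero])
    rwa [add_zero] at this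
  | succ k ih =>
    intro K hK ε hε
    have hg := isGood_tsirelsonIter (𝒜 := F) hc k
    obtain ⟨b, hb, hb'⟩ := isSmall_sSup_admissibleSums hF hb h0 hc hg
      (isRestrictionMonotone_tsirelsonIter hc k) ih _ (hK.inter hg ih hε) ε hε
    exact ⟨b, hb.1, max_le hb.2 hb'⟩

/-- Unfolding the implicit equation once multiplies the error by `c`, and the ℓ₁-norms of successive
restrictions add up to at most the whole. On the unit ball of ℓ₁ the iterates thus converge
uniformly, so smallness need only be checked for each iterate. -/
theorem tsirelsonNorm_le_iter_add (hc : c ∈ Set.Ioo (0 : ℝ) 1) (k : ℕ) (x : ℕ →₀ ℝ) :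
    tsirelsonNorm F c x ≤ tsirelsonIter F c k x + c ^ k * sumAbs x := by
  induction k generalizing x with
  | zero =>
    rw [pow_zero, one_mul]
    exact ((isGood_tsirelsonNorm hc).le x).trans
      (le_add_of_nonneg_left ((isGood_tsirelsonIter hc 0).nonneg x))
  | succ k ih =>
    have hg := isGood_tsirelsonIter (𝒜 := F) hc k
    have hpos : 0 ≤ c ^ (k + 1) * sumAbs x := mul_nonneg (pow_nonneg hc.1.le _) (sumAbs_nonneg x)
    have h0 : ⨆ i, |x i| ≤ tsirelsonIter F c (k + 1) x :=
      (monotone_nat_of_le_succ (f := fun j => tsirelsonIter F c j x)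
        fun j => le_max_left _ _) (Nat.zero_le (k + 1))
    rw [tsirelsonNorm_eq hc]
    refine max_le (h0.trans (le_add_of_nonneg_right hpos)) (Real.sSup_le ?_
      (add_nonneg ((isGood_tsirelsonIter hc _).nonneg x) hpos))
    rintro r ⟨n, A, hA, rfl⟩
    calc ∑ i, c * tsirelsonNorm F c (x.filter fun k => k ∈ A i)
        ≤ ∑ i, (c * tsirelsonIter F c k (x.filter fun k => k ∈ A i) +
            c ^ (k + 1) * sumAbs (x.filter fun k => k ∈ A i)) := by
          refine Finset.sum_le_sum fun i _ => ?_
          rw [pow_succ', mul_assoc, ← mul_add]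
          exact mul_le_mul_of_nonneg_left (ih _) hc.1.le
      _ = ∑ i, c * tsirelsonIter F c k (x.filter fun k => k ∈ A i) +
            c ^ (k + 1) * ∑ i, sumAbs (x.filter fun k => k ∈ A i) := by
          rw [Finset.sum_add_distrib, Finset.mul_sum]
      _ ≤ _ := by
          refine add_le_add ?_ ?_
          · exact (le_csSup (hg.bddAbove hc x) ⟨n, A, hA, rfl⟩).trans (le_max_right _ _)
          · exact mul_le_mul_of_nonneg_left (sum_sumAbs_filter_le hA x) (pow_nonneg hc.1.le _)

/-- Convex combinations of small Tsirelson norm exist far out in every sequence of convex sets. -/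
theorem isSmall_tsirelsonNorm (hF : IsHereditary F) (hb : HasNoBranch F) (h0 : ∅ ∈ F)
    (hc : c ∈ Set.Ioo (0 : ℝ) 1) : IsSmall (tsirelsonNorm F c) := by
  intro K hK ε hε
  obtain ⟨k, hk⟩ := exists_pow_lt_of_lt_one (half_pos hε) hc.2
  obtain ⟨b, hb, hb'⟩ := isSmall_tsirelsonIter hF hb h0 hc k K hK (ε / 2) (half_pos hε)
  refine ⟨b, hb, (tsirelsonNorm_le_iter_add hc k b).trans ?_⟩
  have : c ^ k * sumAbs b ≤ ε / 2 :=
    (mul_le_of_le_one_right (pow_nonneg hc.1.le _) (hK.le_one _ _ hb)).trans hk.le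
  linarith

/-- Lower estimate for the Tsirelson norm by sums over successive sets indexed by a finite set of
natural numbers. -/
theorem sum_tsirelsonNorm_filter_le (hc : c ∈ Set.Ioo (0 : ℝ) 1) (V : Finset ℕ)
    (A : ℕ → Finset ℕ) (hne : ∀ v ∈ V, (A v).Nonempty)
    (hlt : ∀ v ∈ V, ∀ w ∈ V, v < w → ∀ a ∈ A v, ∀ b ∈ A w, a < b)
    (hmem : (V.image fun v => sInf (A v : Set ℕ)) ∈ F) (x : ℕ →₀ ℝ) :
    c * ∑ v ∈ V, tsirelsonNorm F c (x.filter fun k => k ∈ A v) ≤ tsirelsonNorm F c x := by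
  have he := fun i => Finset.orderEmbOfFin_mem V rfl i
  have himage : Finset.univ.image (V.orderEmbOfFin rfl) = V := by
    simp
  rw [tsirelsonNorm_eq hc]
  refine le_max_of_le_right (le_csSup ((isGood_tsirelsonNorm hc).bddAbove hc x)
    ⟨V.card, fun i => A (V.orderEmbOfFin rfl i), ⟨fun i => ?_, fun i j hij => ?_, ?_⟩, ?_⟩)
  · exact_mod_cast hne _ (he i)
  · exact_mod_cast hlt _ (he i) _ (he j) ((V.orderEmbOfFin rfl).strictMono hij)
  · rw [← himage, Finset.image_image] at hmem
    exact hmem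
  · rw [← Finset.mul_sum]
    congr 1
    conv_lhs => rw [← himage]
    exact Finset.sum_image fun i _ j _ h => (V.orderEmbOfFin rfl).injective h

/-! ### Orthogonal sequences of projections and optimal decompositions -/

section Projections

variable {Z : Type*} [NormedAddCommGroup Z] [NormedSpace ℝ Z] {P : ℕ → Z →L[ℝ] Z}

/-- Sequences of mutually orthogonal projections. -/
def IsOrthogonal (P : ℕ → Z →L[ℝ] Z) : Prop :=
  ∀ m n z, P m (P n z) = if m = n then P n z else 0

theorem intervalProj_apply (m n : ℕ) (z : Z) :
    intervalProj P m n z = ∑ k ∈ Finset.Ico m n, P k z := by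
  simp [intervalProj]

theorem intervalProj_succ_self (n : ℕ) (z : Z) : intervalProj P n (n + 1) z = P n z := by
  simp [intervalProj_apply]

theorem intervalProj_add {a b d : ℕ} (hab : a ≤ b) (hbd : b ≤ d) (z : Z) :
    intervalProj P a b z + intervalProj P b d z = intervalProj P a d z := by
  simp only [intervalProj_apply]
  exact Finset.sum_Ico_consecutive _ hab hbd

/-- Only support points matter, so interval endpoints may be moved through gaps of the support. -/
theorem intervalProj_congr {a b a' b' : ℕ} {z : Z}
    (h : ∀ k ∈ supp P z, (a ≤ k ∧ k < b) ↔ (a' ≤ k ∧ k < b')) :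
    intervalProj P a b z = intervalProj P a' b' z := by
  classical
  rw [intervalProj_apply, intervalProj_apply, ← Finset.sum_filter_ne_zero,
    ← Finset.sum_filter_ne_zero (s := Finset.Ico a' b')]
  congr 1
  ext k
  simp only [Finset.mem_filter, Finset.mem_Ico]
  exact and_congr_left fun hk => h k hk

theorem intervalProj_mem_c00 (m n : ℕ) (z : Z) : intervalProj P m n z ∈ c00 P := by
  rw [intervalProj_apply]
  exact Submodule.sum_mem _ fun k _ => Submodule.mem_iSup_of_mem k ⟨z, rfl⟩

namespace IsOrthogonal

variable (hP : IsOrthogonal P)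
include hP

theorem apply_intervalProj (j m n : ℕ) (z : Z) :
    P j (intervalProj P m n z) = if m ≤ j ∧ j < n then P j z else 0 := by
  rw [intervalProj_apply, map_sum]
  simp only [hP j]
  rw [Finset.sum_ite_eq]
  simp

theorem intervalProj_intervalProj {a b m n : ℕ} (ham : a ≤ m) (hnb : n ≤ b) (z : Z) :
    intervalProj P m n (intervalProj P a b z) = intervalProj P m n z := by
  rw [intervalProj_apply, intervalProj_apply m n]
  refine Finset.sum_congr rfl fun k hk => ?_
  rw [Finset.mem_Ico] at hk
  rw [hP.apply_intervalProj, if_pos ⟨by omega, by omega⟩]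

theorem exists_intervalProj_eq {z : Z} (hz : z ∈ c00 P) :
    ∃ N, ∀ M ≥ N, intervalProj P 0 M z = z := by
  refine Submodule.iSup_induction (fun n => (P n).range) (motive := fun z =>
    ∃ N, ∀ M ≥ N, intervalProj P 0 M z = z) hz ?_ ⟨0, by simp⟩ ?_
  · rintro n _ ⟨w, rfl⟩
    refine ⟨n + 1, fun M hM => ?_⟩
    rw [intervalProj_apply]
    change ∑ k ∈ Finset.Ico 0 M, P k (P n w) = P n w
    simp only [hP _ n]
    rw [Finset.sum_ite_eq', if_pos (Finset.mem_Ico.2 ⟨Nat.zero_le _, hM⟩)]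
  · rintro x y ⟨N, hN⟩ ⟨N', hN'⟩
    refine ⟨max N N', fun M hM => ?_⟩
    rw [map_add, hN _ ((le_max_left _ _).trans hM), hN' _ ((le_max_right _ _).trans hM)]

theorem exists_bound {z : Z} (hz : z ∈ c00 P) : ∃ N, ∀ n ∈ supp P z, n < N := by
  obtain ⟨N, hN⟩ := hP.exists_intervalProj_eq hz
  refine ⟨N, fun n hn => ?_⟩
  by_contra h
  refine hn ?_
  rw [← hN N le_rfl, hP.apply_intervalProj, if_neg (by omega)]

theorem intervalProj_eq_self {z : Z} (hz : z ∈ c00 P) {a b : ℕ}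
    (h : ∀ k ∈ supp P z, a ≤ k ∧ k < b) : intervalProj P a b z = z := by
  obtain ⟨N, hN⟩ := hP.exists_intervalProj_eq hz
  obtain ⟨M, hM⟩ := hP.exists_bound hz
  rw [← hN (max N M) (le_max_left _ _), hN (max N M) (le_max_left _ _)]
  refine (intervalProj_congr fun k hk => ?_).trans (hN (max N M) (le_max_left _ _))
  have := h k hk
  have := hM k hk
  have := le_max_right N M
  omega

theorem supp_nonempty {z : Z} (hz : z ∈ c00 P) (h0 : z ≠ 0) : (supp P z).Nonempty := by
  by_contra h
  rw [Set.not_nonempty_iff_eq_empty] at h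
  refine h0 ?_
  rw [← hP.intervalProj_eq_self hz (a := 0) (b := 0) (by simp [h])]
  simp [intervalProj_apply]

theorem lt_suppEnd {z : Z} (hz : z ∈ c00 P) {n : ℕ} (hn : n ∈ supp P z) : n < suppEnd P z := by
  obtain ⟨N, hN⟩ := hP.exists_bound hz
  have : n ≤ sSup (supp P z) := le_csSup ⟨N, fun k hk => (hN k hk).le⟩ hn
  rw [suppEnd]
  omega

theorem mem_supp_intervalProj {a b k : ℕ} {z : Z} :
    k ∈ supp P (intervalProj P a b z) ↔ (a ≤ k ∧ k < b) ∧ k ∈ supp P z := by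
  change P k _ ≠ 0 ↔ _ ∧ P k z ≠ 0
  rw [hP.apply_intervalProj]
  by_cases h : a ≤ k ∧ k < b <;> simp [h]

end IsOrthogonal

/-- All interval projections are contractions. -/
def IsContractive (P : ℕ → Z →L[ℝ] Z) : Prop := ∀ m n z, ‖intervalProj P m n z‖ ≤ ‖z‖

theorem IsContractive.norm_mono (hC : IsContractive P) (hP : IsOrthogonal P) {a b m n : ℕ}
    (ham : a ≤ m) (hnb : n ≤ b) (z : Z) :
    ‖intervalProj P m n z‖ ≤ ‖intervalProj P a b z‖ := by
  rw [← hP.intervalProj_intervalProj ham hnb]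
  exact hC _ _ _

section Optimal

variable (hP : IsOrthogonal P) (hC : IsContractive P) {c : ℝ} {z : Z} (hz : z ∈ c00 P)
include hP hC hz

/-- All that is needed about the greedy step: the cut advances without passing the end; unless it is
the end, enlarging the piece by the next index makes its norm exceed `c`; the piece itself is a
single index or has norm at most `c`. -/
theorem nextCut_spec {n : ℕ} (hn : n < suppEnd P z) :
    n < nextCut P c z n ∧ nextCut P c z n ≤ suppEnd P z ∧
      (nextCut P c z n ≠ suppEnd P z → c < ‖intervalProj P n (nextCut P c z n + 1) z‖) ∧
      (nextCut P c z n = n + 1 ∨ ‖intervalProj P n (nextCut P c z n) z‖ ≤ c) := by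
  classical
  rw [nextCut]
  split_ifs with h1 h2
  · refine ⟨by omega, hn, fun _ => ?_, Or.inl rfl⟩
    rw [← intervalProj_succ_self] at h1
    exact h1.trans_le (hC.norm_mono hP le_rfl (by omega) z)
  · set S := {k | n ≤ k ∧ c < ‖intervalProj P n (k + 1) z‖} with hS
    have hmem : sInf S ∈ S := Nat.sInf_mem h2
    have hmin : ∀ k < sInf S, n ≤ k → ‖intervalProj P n (k + 1) z‖ ≤ c := fun k hk hnk => by
      by_contra hcon
      exact Nat.notMem_of_lt_sInf hk ⟨hnk, not_le.1 hcon⟩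
    have hlt : n < sInf S := by
      refine lt_of_le_of_ne hmem.1 fun h => h1 ?_
      have := hmem.2
      rwa [← h, intervalProj_succ_self] at this
    obtain ⟨k, hk⟩ : ∃ k, sInf S = k + 1 := ⟨sInf S - 1, by omega⟩
    have hle : ‖intervalProj P n (sInf S) z‖ ≤ c := by
      rw [hk]; exact hmin k (by omega) (by omega)
    refine ⟨hlt, ?_, fun _ => hmem.2, Or.inr hle⟩
    -- Past the end of the support, enlarging the interval by one index changes nothing, so the norm
    -- could not jump above `c` there.
    by_contra hcon
    refine absurd hmem.2 (not_lt.2 (le_trans (le_of_eq ?_) hle))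
    congr 1
    refine intervalProj_congr fun j hj => ?_
    have := hP.lt_suppEnd hz hj
    omega
  · refine ⟨hn, le_rfl, fun h => absurd rfl h, Or.inr ?_⟩
    obtain ⟨k, hk⟩ : ∃ k, suppEnd P z = k + 1 := ⟨suppEnd P z - 1, by omega⟩
    rw [hk]
    by_contra hcon
    exact h2 ⟨k, by omega, not_le.1 hcon⟩

variable (h0 : z ≠ 0)
include h0

omit hC in
theorem optCut_zero_lt : optCut P c z 0 < suppEnd P z :=
  hP.lt_suppEnd hz (Nat.sInf_mem (hP.supp_nonempty hz h0))

theorem optCut_optLength : optCut P c z (optLength P c z) = suppEnd P z := by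
  refine Nat.sInf_mem (s := {l | optCut P c z l = suppEnd P z}) ?_
  by_contra! hcon
  have hne : ∀ l, optCut P c z l ≠ suppEnd P z := fun l hl => by
    have : l ∈ {l | optCut P c z l = suppEnd P z} := hl
    rw [hcon] at this
    exact this
  have hlt : ∀ l, optCut P c z l < suppEnd P z := fun l => by
    induction l with
    | zero => exact optCut_zero_lt hP hz h0
    | succ l ih => exact lt_of_le_of_ne (nextCut_spec hP hC hz ih).2.1 (hne _)
  -- If the end were never reached, the cuts would increase strictly forever below it.
  have hmono : StrictMono (optCut P c z) :=
    strictMono_nat_of_lt_succ fun l => (nextCut_spec hP hC hz (hlt l)).1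
  exact absurd (hlt (suppEnd P z)) (not_lt.2 (hmono.id_le _))

theorem optCut_lt {l : ℕ} (hl : l < optLength P c z) : optCut P c z l < suppEnd P z := by
  have hne : ∀ j < optLength P c z, optCut P c z j ≠ suppEnd P z := fun j hj =>
    Nat.notMem_of_lt_sInf (s := {l | optCut P c z l = suppEnd P z}) hj
  induction l with
  | zero => exact optCut_zero_lt hP hz h0
  | succ l ih => exact lt_of_le_of_ne (nextCut_spec hP hC hz (ih (by omega))).2.1 (hne _ hl)

theorem optCut_mono {i j : ℕ} (hij : i ≤ j) (hj : j ≤ optLength P c z) :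
    optCut P c z i ≤ optCut P c z j := by
  induction j, hij using Nat.le_induction with
  | base => exact le_rfl
  | succ j _ ih =>
    exact (ih (by omega)).trans
      (nextCut_spec hP hC hz (optCut_lt hP hC hz h0 (by omega))).1.le

theorem sum_optPiece : ∑ i ∈ Finset.range (optLength P c z), optPiece P c z i = z := by
  have key : ∀ l ≤ optLength P c z, ∑ i ∈ Finset.range l, optPiece P c z i =
      intervalProj P (optCut P c z 0) (optCut P c z l) z := by
    intro l hl
    induction l with
    | zero => simp [intervalProj_apply]
    | succ l ih =>
      rw [Finset.sum_range_succ, ih (by omega), optPiece]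
      exact intervalProj_add (optCut_mono hP hC hz h0 (Nat.zero_le _) (by omega))
        (optCut_mono hP hC hz h0 (by omega) hl) z
  rw [key _ le_rfl, optCut_optLength hP hC hz h0]
  exact hP.intervalProj_eq_self hz fun k hk => ⟨Nat.sInf_le hk, hP.lt_suppEnd hz hk⟩

/-- The optimal decomposition has large pieces: the functional is large on every interval between
two minima of supports. -/
theorem lt_norm_intervalProj_of_mem_optMins {b b' : ℕ} (hb : b ∈ optMins P c z)
    (hb' : b' ∈ optMins P c z) (hlt : b < b') : c < ‖intervalProj P b (b' + 1) z‖ := by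
  classical
  obtain ⟨i, hi, hib⟩ := Finset.mem_image.1 hb
  obtain ⟨j, hj, hjb⟩ := Finset.mem_image.1 hb'
  rw [Finset.mem_filter, Finset.mem_range] at hi hj
  have hmem : ∀ i, optPiece P c z i ≠ 0 →
      sInf (supp P (optPiece P c z i)) ∈ supp P (optPiece P c z i) := fun i h =>
    Nat.sInf_mem (hP.supp_nonempty (intervalProj_mem_c00 _ _ _) h)
  have h1 := hP.mem_supp_intervalProj.1 (hmem i hi.2)
  have h2 := hP.mem_supp_intervalProj.1 (hmem j hj.2)
  rw [hib] at h1
  rw [hjb] at h2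
  have hij : i < j := by
    by_contra hcon
    rcases (not_lt.1 hcon).eq_or_lt with rfl | h
    · exact hlt.ne (hib.symm.trans hjb)
    · have : optCut P c z (j + 1) ≤ optCut P c z i := optCut_mono hP hC hz h0 h hi.1.le
      have h3 := h2.1.2
      have h4 := h1.1.1
      omega
  have hcut := optCut_mono hP hC hz h0 (Nat.succ_le_of_lt hij) hj.1.le
  have hspec := nextCut_spec (c := c) hP hC hz (optCut_lt hP hC hz h0 hi.1)
  have hne : optCut P c z (i + 1) ≠ suppEnd P z :=
    (optCut_lt hP hC hz h0 (show i + 1 < optLength P c z by omega)).ne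
  have h3 := hspec.2.2.1 hne
  -- No support point lies between the cut and `b`, the minimum of its piece, so the interval
  -- beginning at the cut may begin at `b`; monotonicity then extends it to `b'`, which lies at or
  -- after the next cut.
  have h4 : intervalProj P (optCut P c z i) (optCut P c z (i + 1) + 1) z =
      intervalProj P b (optCut P c z (i + 1) + 1) z := by
    refine intervalProj_congr fun k hk => ?_
    refine ⟨fun h => ⟨?_, h.2⟩, fun h => ⟨h1.1.1.trans h.1, h.2⟩⟩
    by_contra hkb
    refine hkb (hib ▸ Nat.sInf_le (hP.mem_supp_intervalProj.2 ⟨⟨h.1, ?_⟩, hk⟩))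
    exact (not_le.1 hkb).trans h1.1.2
  refine (h3.trans_eq (congrArg norm h4)).trans_le (hC.norm_mono hP le_rfl ?_ z)
  exact Nat.succ_le_succ (hcut.trans h2.1.1)

end Optimal

theorem optMins_zero (c : ℝ) : optMins P c (0 : Z) = ∅ := by
  simp [optMins, optPiece]

/-- The non-zero pieces of the optimal decomposition form a `c`-decomposition. -/
theorem exists_isCDecomposition_of_optMins (hP : IsOrthogonal P) (hC : IsContractive P) {c : ℝ}
    {z : Z} (hz : z ∈ c00 P) {𝒜 : Set (Finset ℕ)} (hA : optMins P c z ∈ 𝒜) :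
    ∃ (l : ℕ) (y : Fin l → Z), IsCDecomposition P c z y ∧
      IsAdmissible 𝒜 fun i => supp P (y i) := by
  classical
  rcases eq_or_ne z 0 with rfl | h0
  · refine ⟨0, Fin.elim0, ⟨⟨fun i => i.elim0, fun i => i.elim0, fun i => i.elim0⟩, by simp,
      fun i => i.elim0⟩, fun i => i.elim0, fun i => i.elim0, ?_⟩
    rw [optMins_zero] at hA
    simpa using hA
  set s := (Finset.range (optLength P c z)).filter fun i => optPiece P c z i ≠ 0 with hs
  let e := s.orderEmbOfFin rfl
  have he : ∀ i, e i < optLength P c z ∧ optPiece P c z (e i) ≠ 0 := fun i => by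
    have := Finset.orderEmbOfFin_mem s rfl i
    have := Finset.mem_filter.1 this
    rwa [Finset.mem_range] at this
  have himage : Finset.univ.image e = s := by simp [e]
  have hlt : ∀ i j, i < j → ∀ a ∈ supp P (optPiece P c z (e i)),
      ∀ b ∈ supp P (optPiece P c z (e j)), a < b := by
    intro i j hij a ha b hb
    have h1 := (hP.mem_supp_intervalProj.1 ha).1.2
    have h2 := (hP.mem_supp_intervalProj.1 hb).1.1
    have h3 : e i < e j := e.strictMono hij
    exact h1.trans_le ((optCut_mono hP hC hz h0 (Nat.succ_le_of_lt h3) (he j).1.le).trans h2)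
  refine ⟨s.card, fun i => optPiece P c z (e i), ⟨⟨fun i => intervalProj_mem_c00 _ _ _,
    fun i => (he i).2, hlt⟩, ?_, fun i => ?_⟩,
    fun i => hP.supp_nonempty (intervalProj_mem_c00 _ _ _) (he i).2, hlt, ?_⟩
  · refine (sum_optPiece (c := c) hP hC hz h0).symm.trans ?_
    rw [← Finset.sum_filter_ne_zero]
    have := Finset.sum_image (s := Finset.univ) (f := optPiece P c z) (g := e)
      fun i _ j _ h => e.injective h
    rwa [himage] at this
  · have hspec := nextCut_spec (c := c) hP hC hz (optCut_lt hP hC hz h0 (he i).1)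
    refine hspec.2.2.2.imp_left fun h => ?_
    obtain ⟨k, hk⟩ := hP.supp_nonempty (intervalProj_mem_c00 _ _ _) (he i).2
    rw [Set.ncard_eq_one]
    refine ⟨k, Set.eq_singleton_iff_unique_mem.2 ⟨hk, fun j hj => ?_⟩⟩
    have h1 := (hP.mem_supp_intervalProj.1 hk).1
    have h2 := (hP.mem_supp_intervalProj.1 hj).1
    change _ ∧ _ < nextCut P c z _ at h1 h2
    omega
  · rw [optMins, ← hs, ← himage, Finset.image_image] at hA
    exact hA

end Projections

namespace FDD

variable {X : Type*} [NormedAddCommGroup X] [NormedSpace ℝ X] [CompleteSpace X] (E : FDD X)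

/-! ### Projections of an FDD and their adjoints -/

theorem dualProj_apply (n : ℕ) (f : StrongDual ℝ X) (x : X) : E.dualProj n f x = f (E.proj n x) :=
  rfl

/-- By uniqueness, the expansion of a vector of the `n`-th subspace has that vector as its only
possibly non-zero term. -/
theorem isOrthogonal_proj : IsOrthogonal E.proj := by
  intro m n x
  refine (congrFun (E.coord_eq (x := E.proj n x) (y := fun k => if k = n then E.proj n x else 0)
    (fun k => ?_) ?_) m).symm
  · split_ifs with hk
    · exact hk ▸ E.coord_mem x n
    · exact Submodule.zero_mem _
  · refine tendsto_const_nhds.congr' ?_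
    filter_upwards [eventually_gt_atTop n] with N hN
    rw [Finset.sum_ite_eq', if_pos (Finset.mem_range.2 hN)]

theorem isOrthogonal_dualProj : IsOrthogonal E.dualProj := by
  intro m n f
  ext x
  rw [dualProj_apply, dualProj_apply, E.isOrthogonal_proj]
  by_cases h : m = n
  · subst h
    simp [dualProj_apply]
  · simp [h, Ne.symm h]

theorem intervalProj_dualProj_apply (m n : ℕ) (f : StrongDual ℝ X) (x : X) :
    intervalProj E.dualProj m n f x = f (intervalProj E.proj m n x) := by
  rw [intervalProj_apply, intervalProj_apply, map_sum]
  simp [dualProj_apply]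

variable {E}

theorem IsBimonotone.isContractive_proj (hE : E.IsBimonotone) : IsContractive E.proj :=
  fun m n x => (ContinuousLinearMap.le_opNorm _ x).trans
    (mul_le_of_le_one_left (norm_nonneg _) (hE m n))

theorem IsBimonotone.isContractive_dualProj (hE : E.IsBimonotone) : IsContractive E.dualProj :=
  fun m n f => ContinuousLinearMap.opNorm_le_bound _ (norm_nonneg _) fun x => by
    rw [E.intervalProj_dualProj_apply]
    exact (f.le_opNorm _).trans
      (mul_le_mul_of_nonneg_left (hE.isContractive_proj m n x) (norm_nonneg _))

variable (E)

theorem tendsto_intervalProj (x : X) :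
    Tendsto (fun N => intervalProj E.proj 0 N x) atTop (𝓝 x) := by
  refine (E.tendsto_coord x).congr fun N => ?_
  rw [intervalProj_apply, Finset.range_eq_Ico]
  rfl

theorem apply_eq_zero_of_disjoint {f : StrongDual ℝ X} {z : X} (hz : z ∈ c00 E.proj)
    (h : ∀ n ∈ supp E.proj z, n ∉ supp E.dualProj f) : f z = 0 := by
  obtain ⟨N, hN⟩ := E.isOrthogonal_proj.exists_intervalProj_eq hz
  rw [← hN N le_rfl, intervalProj_apply, map_sum]
  refine Finset.sum_eq_zero fun n _ => ?_
  by_cases hn : n ∈ supp E.proj z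
  · have h1 : E.dualProj n f = 0 := not_not.1 (h n hn)
    rw [← dualProj_apply, h1]
    rfl
  · have h1 : E.proj n z = 0 := not_not.1 hn
    rw [h1, map_zero]

theorem finiteDimensional_range_intervalProj (m n : ℕ) :
    FiniteDimensional ℝ (intervalProj E.proj m n).range := by
  have : ∀ k, FiniteDimensional ℝ (E.space k) := E.finiteDimensional
  refine Submodule.finiteDimensional_of_le
    (S₂ := (Finset.Ico m n).sup E.space) ?_
  rintro _ ⟨x, rfl⟩
  change intervalProj E.proj m n x ∈ _
  rw [intervalProj_apply]
  exact Submodule.sum_mem _ fun k hk => Finset.le_sup (f := E.space) hk (E.coord_mem x k)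

variable {E}

/-! ### Weak* compactness and the regular family of a shrinking FDD -/

/-- Weak* limits of functionals: largeness on intervals passes to the limit because the interval
projections have finite rank. -/
theorem IsBimonotone.exists_weak_limit (hE : E.IsBimonotone) (f : ℕ → StrongDual ℝ X)
    (hf : ∀ k, ‖f k‖ ≤ 1) :
    ∃ g : StrongDual ℝ X, ∀ (m n : ℕ) (c : ℝ),
      (∀ᶠ k in atTop, c < ‖intervalProj E.dualProj m n (f k)‖) →
        c ≤ ‖intervalProj E.dualProj m n g‖ := by
  let U : Ultrafilter ℕ := hyperfilter ℕ
  have hU : (U : Filter ℕ) ≤ atTop := by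
    rw [← Nat.cofinite_eq_atTop]; exact hyperfilter_le_cofinite
  obtain ⟨g, -, hg⟩ := (WeakDual.isCompact_closedBall (0 : StrongDual ℝ X) 1).ultrafilter_le_nhds
    (U.map fun k => StrongDual.toWeakDual (f k)) (by
      rw [le_principal_iff]
      refine Filter.mem_map.2 (Eventually.of_forall fun k => ?_)
      change f k ∈ Metric.closedBall 0 1
      simpa using hf k)
  have hlim : ∀ x, Tendsto (fun k => f k x) U (𝓝 (WeakDual.toStrongDual g x)) := fun x =>
    ((WeakDual.eval_continuous x).tendsto g).comp hg
  refine ⟨WeakDual.toStrongDual g, fun m n c hc => ?_⟩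
  have := E.finiteDimensional_range_intervalProj m n
  have hS : IsCompact (((↑) : (intervalProj E.proj m n).range → X) '' Metric.closedBall 0 1) :=
    (ProperSpace.isCompact_closedBall _ _).image continuous_subtype_val
  -- Vectors witnessing largeness, taken from a compact ball of a finite dimensional space; 0 is a
  -- dummy for the remaining `k`.
  have hw : ∀ k, ∃ w ∈ (((↑) : (intervalProj E.proj m n).range → X) '' Metric.closedBall 0 1),
      c < ‖intervalProj E.dualProj m n (f k)‖ → c ≤ |f k w| := by
    intro k
    by_cases hk : c < ‖intervalProj E.dualProj m n (f k)‖
    · obtain ⟨x, hx, hxc⟩ := ContinuousLinearMap.exists_lt_apply_of_lt_opNorm _ hk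
      refine ⟨intervalProj E.proj m n x, ⟨⟨_, ⟨x, rfl⟩⟩, ?_, rfl⟩, fun _ => ?_⟩
      · rw [mem_closedBall_zero_iff]
        exact (hE.isContractive_proj m n x).trans hx.le
      · rw [E.intervalProj_dualProj_apply] at hxc
        exact hxc.le
    · exact ⟨0, ⟨0, by simp, rfl⟩, fun h => absurd h hk⟩
  choose w hwS hwc using hw
  obtain ⟨y, hyS, hy⟩ := hS.ultrafilter_le_nhds (U.map w)
    (le_principal_iff.2 (Filter.mem_map.2 (Eventually.of_forall hwS)))
  have hy : Tendsto w U (𝓝 y) := hy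
  obtain ⟨⟨y, x, rfl⟩, hy1, rfl⟩ := hyS
  have hy1 : ‖intervalProj E.proj m n x‖ ≤ 1 := mem_closedBall_zero_iff.1 hy1
  have hy : Tendsto w U (𝓝 (intervalProj E.proj m n x)) := hy
  -- Norm convergence of the witnesses and the common bound on the functionals allow both to vary at
  -- once.
  have hdiff : Tendsto (fun k => f k (w k) - f k (intervalProj E.proj m n x)) U (𝓝 0) := by
    refine squeeze_zero_norm (fun k => ?_) (tendsto_iff_norm_sub_tendsto_zero.1 hy)
    rw [← map_sub]
    exact ((f k).le_opNorm _).trans (mul_le_of_le_one_left (norm_nonneg _) (hf k))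
  have hfw : Tendsto (fun k => f k (w k)) U
      (𝓝 (WeakDual.toStrongDual g (intervalProj E.proj m n x))) := by
    simpa using hdiff.add (hlim (intervalProj E.proj m n x))
  have h1 : c ≤ |WeakDual.toStrongDual g (intervalProj E.proj m n x)| :=
    ge_of_tendsto hfw.abs (by
      filter_upwards [hU hc] with k hk
      exact hwc k hk)
  refine h1.trans ?_
  have h2 := (intervalProj E.dualProj m n (WeakDual.toStrongDual g)).le_opNorm
    (intervalProj E.proj m n x)
  rw [E.intervalProj_dualProj_apply,
    E.isOrthogonal_proj.intervalProj_intervalProj le_rfl le_rfl] at h2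
  exact h2.trans (mul_le_of_le_one_right (norm_nonneg _) hy1)

/-- If the FDD is shrinking then the optimal decompositions of the functionals in the unit ball are
admissible for a regular family. -/
theorem IsBimonotone.exists_isRegular_optMins (hE : E.IsBimonotone) (hS : E.IsShrinking) {c : ℝ}
    (hc : 0 < c) :
    ∃ 𝒜 : Set (Finset ℕ), IsRegular 𝒜 ∧ ∀ f : StrongDual ℝ X, ‖f‖ ≤ 1 → f ∈ c00 E.dualProj →
      optMins E.dualProj c f ∈ 𝒜 := by
  suffices h : _ from
    (exists_isRegular_superset {B | ∃ f : StrongDual ℝ X, ‖f‖ ≤ 1 ∧ f ∈ c00 E.dualProj ∧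
      optMins E.dualProj c f = B} h).imp fun 𝒜 hA => ⟨hA.1, fun f h1 h2 => hA.2 ⟨f, h1, h2, rfl⟩⟩
  intro b hb
  by_contra! hcon
  have hP := E.isOrthogonal_dualProj
  have hC := hE.isContractive_dualProj
  have hf : ∀ k, ∃ f : StrongDual ℝ X, ‖f‖ ≤ 1 ∧ f ∈ c00 E.dualProj ∧
      ∀ i < k, b i ∈ optMins E.dualProj c f := by
    intro k
    obtain ⟨_, ⟨f, h1, h2, rfl⟩, h3⟩ := hcon k
    exact ⟨f, h1, h2, fun i hi => h3 (Finset.mem_image_of_mem _ (Finset.mem_range.2 hi))⟩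
  choose f hf1 hf0 hfb using hf
  obtain ⟨g, hg⟩ := hE.exists_weak_limit f hf1
  -- For all large `k` both `b i` and `b (i + 1)` are minima of the optimal decomposition of `f k`,
  -- so `f k` is large on the interval joining them.
  have hgc : ∀ i, c ≤ ‖intervalProj E.dualProj (b i) (b (i + 1) + 1) g‖ := fun i => by
    refine hg _ _ c ?_
    filter_upwards [eventually_gt_atTop (i + 1)] with k hk
    have h0 : f k ≠ 0 := by
      intro h0
      have := hfb k i (by omega)
      rw [h0, optMins_zero] at this
      exact Finset.notMem_empty _ this
    exact lt_norm_intervalProj_of_mem_optMins hP hC (hf0 k) h0 (hfb k i (by omega))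
      (hfb k (i + 1) hk) (hb (Nat.lt_succ_self i))
  obtain ⟨h, hh, hgh⟩ := Metric.mem_closure_iff.1 (hS g) c hc
  rw [dist_eq_norm] at hgh
  obtain ⟨N, hN⟩ := hP.exists_bound hh
  -- The interval lies past the support of `h`, so projecting `g - h` leaves a part of `g` of norm
  -- at least `c`, although `‖g - h‖ < c`.
  have hz : intervalProj E.dualProj (b N) (b (N + 1) + 1) h = 0 := by
    rw [intervalProj_apply]
    refine Finset.sum_eq_zero fun k hk => ?_
    by_contra hne
    have h1 := hN k hne
    have h2 := (Finset.mem_Ico.1 hk).1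
    have h3 := hb.id_le N
    simp only [id] at h3
    omega
  have h1 := hC (b N) (b (N + 1) + 1) (g - h)
  rw [map_sub, hz, sub_zero] at h1
  exact absurd ((hgc N).trans h1) (not_le.2 hgh)

/-- The finitely supported functionals in the unit ball are `1`-norming. -/
theorem IsBimonotone.isNorming (hE : E.IsBimonotone) :
    IsNorming 1 {f : StrongDual ℝ X | ‖f‖ ≤ 1 ∧ f ∈ c00 E.dualProj} := by
  intro z
  rw [one_mul]
  refine le_of_tendsto (E.tendsto_intervalProj z).norm (Eventually.of_forall fun N => ?_)
  obtain ⟨g, hg, hgz⟩ := exists_dual_vector'' ℝ (intervalProj E.proj 0 N z)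
  refine le_csSup ⟨‖z‖, ?_⟩ ⟨intervalProj E.dualProj 0 N g,
    ⟨(hE.isContractive_dualProj _ _ _).trans hg, intervalProj_mem_c00 _ _ _⟩, ?_⟩
  · rintro _ ⟨f, hf, rfl⟩
    exact (f.le_opNorm z).trans (mul_le_of_le_one_left (norm_nonneg _) hf.1)
  · dsimp only
    rw [E.intervalProj_dualProj_apply, hgz]
    simp

end FDD

/-! ### Upper Tsirelson estimates -/

theorem norm_sum_tsirelsonBasis (𝒜 : Set (Finset ℕ)) (c : Set.Ioo (0 : ℝ) 1) (s : Finset ℕ)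
    (p : ℕ → ℕ) (a : ℕ → ℝ) :
    ‖∑ i ∈ s, a i • tsirelsonBasis 𝒜 c (p i)‖ =
      tsirelsonNorm 𝒜 c (∑ i ∈ s, Finsupp.single (p i) (a i)) := by
  let e : ℕ → PreTsirelson 𝒜 c := fun i => (Finsupp.single i 1 : ℕ →₀ ℝ)
  have h : ∑ i ∈ s, a i • tsirelsonBasis 𝒜 c (p i) =
      ((∑ i ∈ s, a i • e (p i) : PreTsirelson 𝒜 c) : TsirelsonSpace 𝒜 c) := by
    have := map_sum (UniformSpace.Completion.toCompl (α := PreTsirelson 𝒜 c))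
      (fun i => a i • e (p i)) s
    refine Eq.trans (Finset.sum_congr rfl fun i _ => ?_) this.symm
    exact (UniformSpace.Completion.coe_smul (a i) (e (p i))).symm
  rw [h, UniformSpace.Completion.norm_coe]
  change tsirelsonNorm 𝒜 c (∑ i ∈ s, a i • (Finsupp.single (p i) 1 : ℕ →₀ ℝ)) = _
  simp

theorem filter_sum_single {p : ℕ → ℕ} (hp : Function.Injective p) {G H : Finset ℕ} (hH : H ⊆ G)
    (a : ℕ → ℝ) :
    (∑ l ∈ G, Finsupp.single (p l) (a l)).filter (fun k => k ∈ H.image p) =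
      ∑ l ∈ H, Finsupp.single (p l) (a l) := by
  classical
  rw [Finsupp.filter_sum, ← Finset.sum_subset hH]
  · refine Finset.sum_congr rfl fun l hl => Finsupp.filter_single_of_pos _ ?_
    exact Finset.mem_image_of_mem p hl
  · intro l _ hl
    refine Finsupp.filter_single_of_neg _ fun h => hl ?_
    obtain ⟨j, hj, hjl⟩ := Finset.mem_image.1 h
    exact hp hjl ▸ hj

theorem sInf_image_coe {p : ℕ → ℕ} (hp : StrictMono p) {H : Finset ℕ} (hH : H.Nonempty) :
    sInf ((H.image p : Finset ℕ) : Set ℕ) = p (H.min' hH) := by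
  refine le_antisymm (Nat.sInf_le ?_) ?_
  · exact_mod_cast Finset.mem_image_of_mem p (H.min'_mem hH)
  · refine le_csInf ⟨_, by exact_mod_cast Finset.mem_image_of_mem p (H.min'_mem hH)⟩ fun x hx => ?_
    obtain ⟨l, hl, rfl⟩ := Finset.mem_image.1 (Finset.mem_coe.1 hx)
    exact hp.monotone (H.min'_le l hl)

namespace FDD

variable {X : Type*} [NormedAddCommGroup X] [NormedSpace ℝ X] [CompleteSpace X] {E : FDD X}

theorem min_supp_mem {z : ℕ → X} (hz : IsBlockSequence E.proj z) (l : ℕ) :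
    sInf (supp E.proj (z l)) ∈ supp E.proj (z l) :=
  Nat.sInf_mem (E.isOrthogonal_proj.supp_nonempty (hz.mem_c00 l) (hz.ne_zero l))

theorem strictMono_min_supp {z : ℕ → X} (hz : IsBlockSequence E.proj z) :
    StrictMono fun l => sInf (supp E.proj (z l)) := fun i j hij =>
  hz.lt i j hij _ (min_supp_mem hz i) _ (min_supp_mem hz j)

/-- A functional with an admissible `c`-decomposition splits the index set of a block sequence into
intervals, on each of which it is `c`-small up to the last block. -/
theorem exists_grouping {z : ℕ → X} (hz : IsBlockSequence E.proj z) {c : ℝ} (hc : 0 ≤ c)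
    {𝒜 : Set (Finset ℕ)} (hA : IsRegular 𝒜) {f : StrongDual ℝ X} {L : ℕ}
    {y : Fin L → StrongDual ℝ X} (hy : IsCDecomposition E.dualProj c f y)
    (hyA : IsAdmissible 𝒜 fun i => supp E.dualProj (y i)) :
    ∃ J : ℕ → ℕ, Monotone J ∧
      (∀ (v : ℕ) (H : Finset ℕ) (a : ℕ → ℝ), (∀ l ∈ H, J l = v ∧ ∃ l' > l, J l' = v) →
        |f (∑ l ∈ H, a l • z l)| ≤ c * ‖∑ l ∈ H, a l • z l‖) ∧
      ∀ (V : Finset ℕ) (r : ℕ → ℕ), 0 ∉ V → (∀ v ∈ V, J (r v) = v) →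
        V.image (fun v => sInf (supp E.proj (z (r v)))) ∈ 𝒜 := by
  classical
  set k : ℕ → ℕ := fun l => sInf (supp E.proj (z l)) with hk
  have hkmem : ∀ l, k l ∈ supp E.proj (z l) := min_supp_mem hz
  have hkmono : StrictMono k := strictMono_min_supp hz
  set q : Fin L → ℕ := fun j => sInf (supp E.dualProj (y j)) with hq
  have hqmem : ∀ j, q j ∈ supp E.dualProj (y j) := fun j => Nat.sInf_mem (hyA.nonempty j)
  -- `J l` counts the pieces of `f` that start strictly before the block `z l`. In group `v > 0` the
  -- active piece is `v - 1`: earlier pieces end before the block, and later ones start no earlier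
  -- than a subsequent block of the group. The last block of a group may meet several pieces and is
  -- therefore excluded.
  let J : ℕ → ℕ := fun l => Finset.univ.sup fun j : Fin L => if q j < k l then (j : ℕ) + 1 else 0
  have hJle : ∀ l j, q j < k l → (j : ℕ) + 1 ≤ J l := fun l j h => by
    have := Finset.le_sup (f := fun j : Fin L => if q j < k l then (j : ℕ) + 1 else 0)
      (Finset.mem_univ j)
    simpa only [if_pos h] using this
  have hJex : ∀ l, J l ≠ 0 → ∃ j : Fin L, (j : ℕ) + 1 = J l ∧ q j < k l := fun l hl => by
    have hne : (Finset.univ : Finset (Fin L)).Nonempty := by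
      by_contra h
      rw [Finset.not_nonempty_iff_eq_empty] at h
      exact hl (by simp only [J, h, Finset.sup_empty, bot_eq_zero])
    obtain ⟨j, -, hj⟩ := Finset.exists_mem_eq_sup _ hne
      fun j : Fin L => if q j < k l then (j : ℕ) + 1 else 0
    by_cases h : q j < k l
    · exact ⟨j, by rw [if_pos h] at hj; exact hj.symm, h⟩
    · rw [if_neg h] at hj
      exact absurd hj hl
  have hJmono : Monotone J := fun l l' hl => Finset.sup_mono_fun fun j _ => by
    have := hkmono.monotone hl
    split_ifs <;> omega
  -- the functionals that do not see the block
  have hlate : ∀ (l v : ℕ) (j : Fin L), (∃ l' > l, J l' = v) → v ≤ (j : ℕ) → y j (z l) = 0 := by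
    rintro l v j ⟨l', hl', rfl⟩ hj
    refine E.apply_eq_zero_of_disjoint (hz.mem_c00 l) fun n hn hn' => ?_
    have h1 : q j ≤ n := Nat.sInf_le hn'
    have h2 : n < k l' := hz.lt l l' hl' n hn _ (hkmem l')
    have := hJle l' j (h1.trans_lt h2)
    omega
  have hearly : ∀ l (i j : Fin L), (j : ℕ) < i → q i < k l → y j (z l) = 0 := by
    intro l i j hji hi
    refine E.apply_eq_zero_of_disjoint (hz.mem_c00 l) fun n hn hn' => ?_
    have h1 : n < q i := hyA.lt j i hji n hn' _ (hqmem i)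
    have h2 : k l ≤ n := Nat.sInf_le hn
    omega
  refine ⟨J, hJmono, fun v H a hH => ?_, fun V r hV hr => ?_⟩
  · have hrhs : 0 ≤ c * ‖∑ l ∈ H, a l • z l‖ := mul_nonneg hc (norm_nonneg _)
    rcases Nat.eq_zero_or_pos v with rfl | hv
    · have : f (∑ l ∈ H, a l • z l) = 0 := by
        rw [map_sum]
        refine Finset.sum_eq_zero fun l hl => ?_
        rw [map_smul, hy.sum_eq, sum_apply,
          Finset.sum_eq_zero fun j _ => hlate l 0 j (hH l hl).2 (Nat.zero_le _), smul_zero]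
      rwa [this, abs_zero]
    · rcases H.eq_empty_or_nonempty with rfl | ⟨l₀, hl₀⟩
      · simp
      obtain ⟨i, hi, -⟩ := hJex l₀ (by have := (hH l₀ hl₀).1; omega)
      rw [(hH l₀ hl₀).1] at hi
      have hqi : ∀ l ∈ H, q i < k l := fun l hl => by
        obtain ⟨j, hj, hjl⟩ := hJex l (by have := (hH l hl).1; omega)
        have : j = i := Fin.ext (by have := (hH l hl).1; omega)
        exact this ▸ hjl
      have hfi : f (∑ l ∈ H, a l • z l) = y i (∑ l ∈ H, a l • z l) := by
        rw [map_sum, map_sum]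
        refine Finset.sum_congr rfl fun l hl => ?_
        rw [map_smul, map_smul, hy.sum_eq, sum_apply, Finset.sum_eq_single i]
        · intro j _ hji
          rcases lt_or_gt_of_ne hji with h | h
          · exact hearly l i j h (hqi l hl)
          · have h : (i : ℕ) < j := h
            exact hlate l v j (hH l hl).2 (by omega)
        · simp
      rw [hfi]
      -- A piece with one-point support lives at `q i`, before all blocks of its group, and vanishes
      -- on them; this is why such pieces may have large norm.
      rcases hy.small i with h | h
      · have : y i (∑ l ∈ H, a l • z l) = 0 := by
          rw [map_sum]
          refine Finset.sum_eq_zero fun l hl => ?_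
          rw [map_smul, E.apply_eq_zero_of_disjoint (hz.mem_c00 l), smul_zero]
          intro n hn hn'
          obtain ⟨b, hb⟩ := Set.ncard_eq_one.1 h
          have h1 : n = q i := by
            have h2 := hqmem i
            rw [hb] at hn' h2
            exact hn'.trans h2.symm
          have h2 : k l ≤ n := Nat.sInf_le hn
          have := hqi l hl
          omega
        rwa [this, abs_zero]
      · exact ((y i).le_opNorm _).trans (mul_le_mul_of_nonneg_right h (norm_nonneg _))
  · have hex : ∀ v, ∃ j : ℕ, v ∈ V → ∃ i : Fin L, (i : ℕ) + 1 = v ∧ j = q i ∧ q i < k (r v) := by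
      intro v
      by_cases hv : v ∈ V
      · obtain ⟨i, hi, hik⟩ := hJex (r v) (by rw [hr v hv]; rintro rfl; exact hV hv)
        exact ⟨q i, fun _ => ⟨i, hi.trans (hr v hv), rfl, hik⟩⟩
      · exact ⟨0, fun h => absurd h hv⟩
    choose g hg using hex
    -- The active piece of a group starts before the representative block, so the representatives
    -- are a spread of minima of pieces. Group 0 has no such piece and must be left out.
    refine hA.isSpreading V g _ ?_ ?_ ?_ ?_
    · intro v hv w hw hvw
      obtain ⟨i, hi, hgi, -⟩ := hg v hv
      obtain ⟨j, hj, hgj, -⟩ := hg w hw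
      rw [hgi, hgj]
      exact hyA.lt i j (Fin.lt_def.2 (by omega)) _ (hqmem i) _ (hqmem j)
    · intro v hv w hw hvw
      refine hkmono ?_
      by_contra hcon
      have := hJmono (not_lt.1 hcon)
      rw [hr v hv, hr w hw] at this
      omega
    · intro v hv
      obtain ⟨i, -, hgi, hlt⟩ := hg v hv
      exact hgi ▸ hlt.le
    · refine hA.hereditary _ hyA.mins_mem _ fun x hx => ?_
      obtain ⟨v, hv, rfl⟩ := Finset.mem_image.1 hx
      obtain ⟨i, -, hgi, -⟩ := hg v hv
      rw [hgi]
      exact Finset.mem_image_of_mem _ (Finset.mem_univ i)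

/-- Upper Tsirelson estimates for normalized block sequences from a norming set of functionals with
admissible decompositions. -/
theorem norm_sum_le_tsirelsonNorm {z : ℕ → X} (hz : IsBlockSequence E.proj z)
    (hz1 : ∀ i, ‖z i‖ = 1) {c d C : ℝ} (hc : 0 ≤ c) (hd : 0 < d) (hC : 0 ≤ C) {𝒜 : Set (Finset ℕ)}
    (hA : IsRegular 𝒜)
    (hD : ∀ x : X, x ≠ 0 → ∃ f : StrongDual ℝ X, d * ‖x‖ ≤ |f x| ∧ ‖f‖ ≤ 1 ∧
      ∃ (l : ℕ) (y : Fin l → StrongDual ℝ X), IsCDecomposition E.dualProj c f y ∧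
        IsAdmissible 𝒜 fun i => supp E.dualProj (y i))
    {φ : Ordinal.{0} → ℕ → Ordinal.{0}} (hφ : IsFundamental φ) {α : Ordinal.{0}} (hα : α < ω₁)
    {m : ℕ → ℕ} (hm : StrictMono m) (hm1 : ∀ i, 1 ≤ m i)
    (hmA : ∀ A ∈ 𝒜, A.image m ∈ schreier φ α) {θ : ℝ} (hθ : θ ∈ Set.Ioo (0 : ℝ) 1)
    (hCθ : 1 + c * C ≤ C * d * θ) (a : ℕ → ℝ) (G : Finset ℕ) :
    ‖∑ l ∈ G, a l • z l‖ ≤ C * tsirelsonNorm (schreier φ (α + 1)) θ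
      (∑ l ∈ G, Finsupp.single (m (sInf (supp E.proj (z l)))) (a l)) := by
  classical
  set p : ℕ → ℕ := fun l => m (sInf (supp E.proj (z l))) with hp
  have hpmono : StrictMono p := hm.comp (strictMono_min_supp hz)
  set T := tsirelsonNorm (schreier φ (α + 1)) θ with hT
  have hg : IsGood T := isGood_tsirelsonNorm hθ
  induction G using Finset.strongInduction with
  | H G ih =>
  rcases eq_or_ne (∑ l ∈ G, a l • z l) 0 with h0 | h0
  · rw [h0, norm_zero]
    exact mul_nonneg hC (hg.nonneg _)
  obtain ⟨f, hfx, hf1, L, y, hy, hyA⟩ := hD _ h0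
  obtain ⟨J, hJ, hJf, hJA⟩ := exists_grouping hz hc hA hy hyA
  set V := G.image J with hV
  let g : ℕ → Finset ℕ := fun v => G.filter fun l => J l = v
  have hgne : ∀ v ∈ V, (g v).Nonempty := fun v hv => by
    obtain ⟨l, hl, rfl⟩ := Finset.mem_image.1 hv
    exact ⟨l, Finset.mem_filter.2 ⟨hl, rfl⟩⟩
  have hgsub : ∀ v, g v ⊆ G := fun v => Finset.filter_subset _ _
  have hgJ : ∀ v, ∀ l ∈ g v, J l = v := fun v l hl => (Finset.mem_filter.1 hl).2
  -- the minima of the groups are admissible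
  let r : ℕ → ℕ := fun v => if hv : (g v).Nonempty then (g v).min' hv else 0
  have hrmem : ∀ v ∈ V, r v ∈ g v := fun v hv => by
    simp only [r, dif_pos (hgne v hv)]
    exact Finset.min'_mem _ _
  have hrlt : ∀ v ∈ V, ∀ w ∈ V, v < w → r v < r w := fun v hv w hw hvw => by
    by_contra hcon
    have := hJ (not_lt.1 hcon)
    rw [hgJ v _ (hrmem v hv), hgJ w _ (hrmem w hw)] at this
    omega
  -- Group 0 is not controlled by `𝒜`; inserting its minimum is the reason for passing from `α` to
  -- `α + 1`.
  have hmins : V.image (fun v => p (r v)) ∈ schreier φ (α + 1) := by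
    have h1 : (V.erase 0).image (fun v => p (r v)) ∈ schreier φ α := by
      have := hmA _ (hJA (V.erase 0) r (Finset.notMem_erase 0 V) fun v hv =>
        hgJ v _ (hrmem v (Finset.mem_of_mem_erase hv)))
      rwa [Finset.image_image] at this
    by_cases h : 0 ∈ V
    · rw [← Finset.insert_erase h, Finset.image_insert]
      refine insert_mem_schreier_succ hφ hα (hm1 _) (fun b hb => ?_) h1
      obtain ⟨v, hv, rfl⟩ := Finset.mem_image.1 hb
      exact hpmono (hrlt 0 h v (Finset.mem_of_mem_erase hv)
        (Nat.pos_of_ne_zero (Finset.ne_of_mem_erase hv)))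
    · rw [Finset.erase_eq_of_notMem h] at h1
      exact schreier_subset_succ h1
  have hsum := sum_tsirelsonNorm_filter_le (F := schreier φ (α + 1)) hθ V (fun v => (g v).image p)
    (fun v hv => (hgne v hv).image p)
    (fun v hv w hw hvw x hx x' hx' => by
      obtain ⟨l, hl, rfl⟩ := Finset.mem_image.1 hx
      obtain ⟨l', hl', rfl⟩ := Finset.mem_image.1 hx'
      refine hpmono ?_
      by_contra hcon
      have := hJ (not_lt.1 hcon)
      rw [hgJ v l hl, hgJ w l' hl'] at this
      omega)
    (by
      convert hmins using 1
      refine Finset.image_congr fun v hv => ?_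
      have hv := hgne v hv
      simp only [sInf_image_coe hpmono hv, r, dif_pos hv])
    (∑ l ∈ G, Finsupp.single (p l) (a l))
  -- estimate on one group
  have hgroup : ∀ v ∈ V, |f (∑ l ∈ g v, a l • z l)| ≤
      (1 + c * C) * T (∑ l ∈ g v, Finsupp.single (p l) (a l)) := by
    intro v hv
    set M := (g v).max' (hgne v hv) with hM
    have hMmem : M ∈ g v := Finset.max'_mem _ _
    have h1 : |f (a M • z M)| ≤ T (∑ l ∈ g v, Finsupp.single (p l) (a l)) := by
      have h2 : |f (a M • z M)| ≤ |a M| := by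
        refine (f.le_opNorm _).trans ((mul_le_of_le_one_left (norm_nonneg _) hf1).trans ?_)
        rw [norm_smul, hz1, mul_one, Real.norm_eq_abs]
      refine h2.trans (le_trans (le_of_eq ?_) (abs_le_tsirelsonNorm hθ _ (p M)))
      rw [Finsupp.finsetSum_apply, Finset.sum_eq_single M]
      · simp
      · intro l _ hl
        exact Finsupp.single_eq_of_ne (hpmono.injective.ne hl.symm)
      · exact fun h => absurd hMmem h
    have h2 : |f (∑ l ∈ (g v).erase M, a l • z l)| ≤
        c * (C * T (∑ l ∈ g v, Finsupp.single (p l) (a l))) := by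
      refine (hJf v _ a fun l hl => ⟨hgJ v l (Finset.mem_of_mem_erase hl), M, ?_, hgJ v M hMmem⟩).trans
        (mul_le_mul_of_nonneg_left ?_ hc)
      · exact lt_of_le_of_ne (Finset.le_max' _ _ (Finset.mem_of_mem_erase hl))
          (Finset.ne_of_mem_erase hl)
      · refine (ih _ ((Finset.erase_ssubset hMmem).trans_subset (hgsub v))).trans
          (mul_le_mul_of_nonneg_left ?_ hC)
        rw [← filter_sum_single hpmono.injective (Finset.erase_subset M (g v))]
        exact isRestrictionMonotone_tsirelsonNorm hθ _ _
    rw [← Finset.add_sum_erase _ _ hMmem, map_add]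
    refine (abs_add_le _ _).trans ?_
    rw [← Finset.add_sum_erase _ (fun l => Finsupp.single (p l) (a l)) hMmem] at h1 h2 ⊢
    linarith
  have hsplit : ∑ l ∈ G, a l • z l = ∑ v ∈ V, ∑ l ∈ g v, a l • z l :=
    (Finset.sum_fiberwise_of_maps_to (fun l hl => Finset.mem_image_of_mem J hl) _).symm
  have hTv : ∀ v, T ((∑ l ∈ G, Finsupp.single (p l) (a l)).filter fun k => k ∈ (g v).image p) =
      T (∑ l ∈ g v, Finsupp.single (p l) (a l)) := fun v => by
    rw [filter_sum_single hpmono.injective (hgsub v)]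
  simp only [hTv, ← hT] at hsum
  have hnn : 0 ≤ ∑ v ∈ V, T (∑ l ∈ g v, Finsupp.single (p l) (a l)) :=
    Finset.sum_nonneg fun v _ => hg.nonneg _
  have hfinal : d * ‖∑ l ∈ G, a l • z l‖ ≤
      d * (C * T (∑ l ∈ G, Finsupp.single (p l) (a l))) := by
    calc d * ‖∑ l ∈ G, a l • z l‖ ≤ |f (∑ l ∈ G, a l • z l)| := hfx
      _ ≤ ∑ v ∈ V, |f (∑ l ∈ g v, a l • z l)| := by
          rw [hsplit, map_sum]
          exact Finset.abs_sum_le_sum_abs _ _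
      _ ≤ (1 + c * C) * ∑ v ∈ V, T (∑ l ∈ g v, Finsupp.single (p l) (a l)) := by
          rw [Finset.mul_sum]
          exact Finset.sum_le_sum hgroup
      _ ≤ (C * d * θ) * ∑ v ∈ V, T (∑ l ∈ g v, Finsupp.single (p l) (a l)) :=
          mul_le_mul_of_nonneg_right hCθ hnn
      _ = d * C * (θ * ∑ v ∈ V, T (∑ l ∈ g v, Finsupp.single (p l) (a l))) := by ring
      _ ≤ d * C * T (∑ l ∈ G, Finsupp.single (p l) (a l)) :=
          mul_le_mul_of_nonneg_left hsum (mul_nonneg hd.le hC)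
      _ = _ := by ring
  exact le_of_mul_le_mul_left hfinal hd

/-- A norming set of functionals with admissible decompositions yields subsequential upper Tsirelson
estimates. -/
theorem exists_hasUpperEstimates {D : Set (StrongDual ℝ X)} {c d : ℝ} {𝒜 : Set (Finset ℕ)}
    (hD1 : ∀ f ∈ D, ‖f‖ ≤ 1) (hc : 0 < c) (hcd : c < d) (hA : IsRegular 𝒜) (hD : IsNorming d D)
    (hDA : ∀ f ∈ D, ∃ (l : ℕ) (y : Fin l → StrongDual ℝ X),
      IsCDecomposition E.dualProj c f y ∧ IsAdmissible 𝒜 fun i => supp E.dualProj (y i))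
    {φ : Ordinal.{0} → ℕ → Ordinal.{0}} (hφ : IsFundamental φ) :
    ∃ α < ω₁, ∃ (c : Set.Ioo (0 : ℝ) 1) (C : ℝ) (m : ℕ → ℕ), 1 ≤ C ∧ StrictMono m ∧
      E.HasUpperEstimates C fun i => tsirelsonBasis (schreier φ α) c (m i) := by
  obtain ⟨α, hα, m, hm, hm1, hmA⟩ :=
    exists_image_mem_schreier hφ hA.isHereditary hA.hasNoBranch hA.empty_mem
  -- Lowering `d` to `e` provides an actual functional in `D` with `e‖x‖ ≤ |f x|`. The choice `θ > c
  -- / e` makes `e * θ - c` positive, so a sufficiently large `C` satisfies the inequality that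
  -- closes the induction.
  obtain ⟨e, hce, hed⟩ := exists_between hcd
  have he : 0 < e := hc.trans hce
  obtain ⟨θ, hθ1, hθ2⟩ := exists_between ((div_lt_one he).2 hce)
  have hθ : θ ∈ Set.Ioo (0 : ℝ) 1 := ⟨(div_pos hc he).trans hθ1, hθ2⟩
  have hθe : 0 < e * θ - c := by
    rw [div_lt_iff₀ he] at hθ1
    linarith
  set C := max 1 (1 / (e * θ - c)) with hC
  have hC1 : 1 ≤ C := le_max_left _ _
  have hCθ : 1 + c * C ≤ C * e * θ := by
    have : 1 ≤ C * (e * θ - c) := by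
      rw [← div_le_iff₀ hθe]
      exact le_max_right _ _
    linarith
  refine ⟨α + 1, isSuccLimit_omega_one.add_one_lt hα, ⟨θ, hθ⟩, C, m, hC1, hm, fun z hz hz1 a N => ?_⟩
  rw [norm_sum_tsirelsonBasis]
  refine norm_sum_le_tsirelsonNorm hz hz1 hc.le he (zero_le_one.trans hC1) hA (fun x hx => ?_) hφ hα
    hm hm1 hmA hθ hCθ a _
  have hx' : e * ‖x‖ < sSup ((fun f : StrongDual ℝ X => |f x|) '' D) :=
    (mul_lt_mul_of_pos_right hed (norm_pos_iff.2 hx)).trans_le (hD x)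
  have hne : ((fun f : StrongDual ℝ X => |f x|) '' D).Nonempty := by
    by_contra hne
    rw [Set.not_nonempty_iff_eq_empty] at hne
    rw [hne, Real.sSup_empty] at hx'
    exact absurd hx' (not_lt.2 (mul_nonneg he.le (norm_nonneg x)))
  obtain ⟨_, ⟨f, hf, rfl⟩, hfx⟩ := exists_lt_of_lt_csSup hne hx'
  exact ⟨f, hfx.le, hD1 f hf, hDA f hf⟩

end FDD

/-! ### From upper Tsirelson estimates to shrinking -/

/-- The probability vectors that vanish before `n`. -/
def tailSimplex (n : ℕ) : Set (ℕ →₀ ℝ) :=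
  {w | (∀ i, 0 ≤ w i) ∧ (Finsupp.linearCombination ℝ fun _ : ℕ => (1 : ℝ)) w = 1 ∧ ∀ i < n, w i = 0}

theorem convex_tailSimplex (n : ℕ) : Convex ℝ (tailSimplex n) := by
  rintro x ⟨hx, hx1, hx0⟩ y ⟨hy, hy1, hy0⟩ a b ha hb hab
  refine ⟨fun i => ?_, ?_, fun i hi => ?_⟩
  · exact add_nonneg (mul_nonneg ha (hx i)) (mul_nonneg hb (hy i))
  · rw [map_add, map_smul, map_smul, hx1, hy1, smul_eq_mul, smul_eq_mul, mul_one, mul_one, hab]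
  · simp [hx0 i hi, hy0 i hi]

theorem sum_eq_one_of_mem_tailSimplex {n : ℕ} {w : ℕ →₀ ℝ} (hw : w ∈ tailSimplex n) :
    ∑ i ∈ w.support, w i = 1 := by
  have := hw.2.1
  rw [Finsupp.linearCombination_apply, Finsupp.sum] at this
  simpa using this

/-- Convex combinations of unit vectors along a subsequence: since `p i ≥ i`, relabelling does not
bring supports closer to the origin. -/
theorem isConvexTail_image_tailSimplex {p : ℕ → ℕ} (hp : StrictMono p) :
    IsConvexTail fun n => Finsupp.lmapDomain ℝ ℝ p '' tailSimplex n := by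
  classical
  refine ⟨fun n => (convex_tailSimplex n).linear_image _, fun n => ?_, fun i j hij => ?_, ?_, ?_⟩
  · refine ⟨_, Finsupp.single n 1, ⟨fun i => ?_, by simp, fun i hi => ?_⟩, rfl⟩
    · rw [Finsupp.single_apply]
      split_ifs <;> norm_num
    · exact Finsupp.single_eq_of_ne hi.ne
  · rintro _ ⟨w, ⟨h1, h2, h3⟩, rfl⟩
    exact ⟨w, ⟨h1, h2, fun k hk => h3 k (hk.trans_le hij)⟩, rfl⟩
  · rintro n _ ⟨w, hw, rfl⟩
    rw [← sum_eq_one_of_mem_tailSimplex hw, Finsupp.lmapDomain_apply, sumAbs,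
      Finsupp.mapDomain_support_of_injective hp.injective,
      Finset.sum_image fun i _ j _ h => hp.injective h]
    refine Finset.sum_le_sum fun i _ => ?_
    rw [Finsupp.mapDomain_apply hp.injective, abs_of_nonneg (hw.1 i)]
  · rintro n _ ⟨w, hw, rfl⟩ i hi
    rw [Finsupp.lmapDomain_apply]
    by_cases h : i ∈ Set.range p
    · obtain ⟨j, rfl⟩ := h
      rw [Finsupp.mapDomain_apply hp.injective]
      exact hw.2.2 j ((hp.id_le j).trans_lt hi)
    · exact Finsupp.mapDomain_of_notMem_range _ _ h

namespace FDD

variable {X : Type*} [NormedAddCommGroup X] [NormedSpace ℝ X] [CompleteSpace X] {E : FDD X}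

/-- If a functional is not a limit of finitely supported functionals, then it is uniformly large on a
normalized block sequence. -/
theorem IsBimonotone.exists_large_block (hE : E.IsBimonotone) {f : StrongDual ℝ X}
    (hf : f ∉ closure (c00 E.dualProj : Set (StrongDual ℝ X))) :
    ∃ η > 0, ∃ z : ℕ → X, IsBlockSequence E.proj z ∧ (∀ i, ‖z i‖ = 1) ∧ ∀ i, η ≤ f (z i) := by
  rw [Metric.mem_closure_iff] at hf
  push Not at hf
  obtain ⟨δ, hδ, hfδ⟩ := hf
  have hP := E.isOrthogonal_proj
  have key : ∀ n, ∃ z N, n ≤ N ∧ z ∈ c00 E.proj ∧ ‖z‖ = 1 ∧ δ / 2 ≤ f z ∧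
      ∀ k ∈ supp E.proj z, n ≤ k ∧ k < N := by
    intro n
    -- The truncation of `f` is finitely supported, hence at distance at least `δ`. A vector
    -- witnessing this is cut down to a finite interval `[n, N)`; normalizing it, up to sign, only
    -- improves the lower bound.
    have h1 : δ / 2 < ‖f - intervalProj E.dualProj 0 n f‖ := by
      rw [← dist_eq_norm]
      exact (half_lt_self hδ).trans_le (hfδ _ (intervalProj_mem_c00 _ _ _))
    obtain ⟨x, hx, hfx⟩ := ContinuousLinearMap.exists_lt_apply_of_lt_opNorm _ h1
    rw [sub_apply, E.intervalProj_dualProj_apply] at hfx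
    have hlim : Tendsto (fun N => ‖f (intervalProj E.proj 0 N x) -
        f (intervalProj E.proj 0 n x)‖) atTop (𝓝 ‖f x - f (intervalProj E.proj 0 n x)‖) :=
      (((f.continuous.tendsto x).comp (E.tendsto_intervalProj x)).sub tendsto_const_nhds).norm
    obtain ⟨N, hN, hnN⟩ := ((hlim.eventually (lt_mem_nhds hfx)).and (eventually_ge_atTop n)).exists
    rw [← map_sub, ← intervalProj_add (Nat.zero_le n) hnN x, add_sub_cancel_left] at hN
    set y := intervalProj E.proj n N x with hy
    have hy0 : y ≠ 0 := by
      rintro h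
      rw [h, map_zero, norm_zero] at hN
      linarith
    have hy1 : ‖y‖ ≤ 1 := (hE.isContractive_proj n N x).trans hx.le
    have hypos : 0 < ‖y‖ := norm_pos_iff.2 hy0
    have hsupp : ∀ (s : ℝ), ∀ k ∈ supp E.proj (s • y), n ≤ k ∧ k < N := fun s k hk => by
      refine (hP.mem_supp_intervalProj (z := x).1 fun h => hk ?_).1
      rw [map_smul, hy, h, smul_zero]
    have hmem : ∀ s : ℝ, s • y ∈ c00 E.proj := fun s =>
      Submodule.smul_mem _ _ (intervalProj_mem_c00 _ _ _)
    rw [Real.norm_eq_abs] at hN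
    have hbig : δ / 2 ≤ ‖y‖⁻¹ * |f y| := by
      refine hN.le.trans (le_mul_of_one_le_left (abs_nonneg _) ((one_le_inv₀ hypos).2 hy1))
    rcases le_total 0 (f y) with hs | hs
    · refine ⟨‖y‖⁻¹ • y, N, hnN, hmem _, ?_, ?_, hsupp _⟩
      · rw [norm_smul, norm_inv, norm_norm, inv_mul_cancel₀ hypos.ne']
      · rw [abs_of_nonneg hs] at hbig
        simpa using hbig
    · refine ⟨(-‖y‖⁻¹) • y, N, hnN, hmem _, ?_, ?_, hsupp _⟩
      · rw [norm_smul, norm_neg, norm_inv, norm_norm, inv_mul_cancel₀ hypos.ne']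
      · rw [abs_of_nonpos hs] at hbig
        simpa using hbig
  choose ζ ν hν hmem hnorm hfζ hsupp using key
  let n : ℕ → ℕ := fun i => ν^[i] 0
  have hn : ∀ i, n (i + 1) = ν (n i) := fun i => Function.iterate_succ_apply' ν i 0
  have hmono : Monotone n := monotone_nat_of_le_succ fun i => by
    rw [hn]; exact hν _
  refine ⟨δ / 2, half_pos hδ, fun i => ζ (n i), ⟨fun i => hmem _, fun i => ?_, ?_⟩,
    fun i => hnorm _, fun i => hfζ _⟩
  · rw [← norm_ne_zero_iff, hnorm]
    exact one_ne_zero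
  · intro i j hij a ha b hb
    have h1 := (hsupp _ a ha).2
    rw [← hn] at h1
    exact h1.trans_le ((hmono (Nat.succ_le_of_lt hij)).trans (hsupp _ b hb).1)

/-- Upper estimates by a subsequence of the basis of a Tsirelson space imply that the FDD is
shrinking. -/
theorem IsBimonotone.isShrinking_of_hasUpperEstimates (hE : E.IsBimonotone)
    {F : Set (Finset ℕ)} (hF : IsHereditary F) (hb : HasNoBranch F) (h0 : ∅ ∈ F)
    {c : Set.Ioo (0 : ℝ) 1} {C : ℝ} (hC : 0 ≤ C) {m : ℕ → ℕ} (hm : StrictMono m)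
    (h : E.HasUpperEstimates C fun i => tsirelsonBasis F c (m i)) : E.IsShrinking := by
  intro f
  by_contra hf
  obtain ⟨η, hη, z, hz, hz1, hfz⟩ := hE.exists_large_block hf
  set p : ℕ → ℕ := fun l => m (sInf (supp E.proj (z l))) with hp
  have hpmono : StrictMono p := hm.comp (strictMono_min_supp hz)
  have hpos : 0 ≤ ‖f‖ * C := mul_nonneg (norm_nonneg _) hC
  -- With this tolerance the upper estimate gives `η ≤ ‖f‖ C η / (‖f‖ C + 1) < η`; the `+ 1` avoids
  -- division by zero.
  obtain ⟨_, ⟨w, hw, rfl⟩, hwε⟩ := isSmall_tsirelsonNorm hF hb h0 c.2 _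
    (isConvexTail_image_tailSimplex hpmono) (η / (‖f‖ * C + 1)) (by positivity)
  obtain ⟨N, hN⟩ : ∃ N, w.support ⊆ Finset.range N :=
    ⟨w.support.sup id + 1, fun i hi => Finset.mem_range.2
      (Nat.lt_succ_of_le (Finset.le_sup (f := id) hi))⟩
  have hsum : ∑ i ∈ Finset.range N, w i = 1 := by
    rw [← sum_eq_one_of_mem_tailSimplex hw]
    exact (Finset.sum_subset hN fun i _ hi => Finsupp.notMem_support_iff.1 hi).symm
  have hmap : ∑ i ∈ Finset.range N, Finsupp.single (p i) (w i) = Finsupp.lmapDomain ℝ ℝ p w := by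
    rw [Finsupp.lmapDomain_apply, Finsupp.mapDomain, Finsupp.sum]
    exact (Finset.sum_subset hN fun i _ hi => by
      rw [Finsupp.notMem_support_iff.1 hi, Finsupp.single_zero]).symm
  have hup := h z hz hz1 w N
  rw [norm_sum_tsirelsonBasis F c (Finset.range N) p w, hmap] at hup
  have hlow : η ≤ ‖f‖ * ‖∑ i ∈ Finset.range N, w i • z i‖ := by
    calc η = ∑ i ∈ Finset.range N, w i * η := by rw [← Finset.sum_mul, hsum, one_mul]
      _ ≤ ∑ i ∈ Finset.range N, w i * f (z i) :=
          Finset.sum_le_sum fun i _ => mul_le_mul_of_nonneg_left (hfz i) (hw.1 i)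
      _ = f (∑ i ∈ Finset.range N, w i • z i) := by simp [map_sum]
      _ ≤ _ := (le_abs_self _).trans (f.le_opNorm _)
  have hlast : η ≤ ‖f‖ * C * (η / (‖f‖ * C + 1)) := by
    refine hlow.trans ?_
    rw [mul_assoc]
    exact mul_le_mul_of_nonneg_left (hup.trans (mul_le_mul_of_nonneg_left hwε hC)) (norm_nonneg _)
  rw [mul_div_assoc', le_div_iff₀ (by positivity)] at hlast
  linarith

end FDD

end BimonotoneFDD

/-! ### The cycle of implications -/

theorem theorem3p6 {X : Type*} [NormedAddCommGroup X] [NormedSpace ℝ X] [CompleteSpace X]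
    (E : BimonotoneFDD.FDD X) (hE : E.IsBimonotone)
    (φ : Ordinal.{0} → ℕ → Ordinal.{0}) (hφ : BimonotoneFDD.IsFundamental φ) :
    List.TFAE [
      E.IsShrinking,
      ∀ c : ℝ, 0 < c → c < 1 → ∃ 𝒜 : Set (Finset ℕ), BimonotoneFDD.IsRegular 𝒜 ∧
        ∀ f : StrongDual ℝ X, ‖f‖ ≤ 1 → f ∈ BimonotoneFDD.c00 E.dualProj →
          BimonotoneFDD.optMins E.dualProj c f ∈ 𝒜,
      ∃ (D : Set (StrongDual ℝ X)) (c d : ℝ) (𝒜 : Set (Finset ℕ)),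
        (∀ f ∈ D, ‖f‖ ≤ 1 ∧ f ∈ BimonotoneFDD.c00 E.dualProj) ∧
        0 < c ∧ c < d ∧ d ≤ 1 ∧ BimonotoneFDD.IsRegular 𝒜 ∧ BimonotoneFDD.IsNorming d D ∧
        ∀ f ∈ D, ∃ (l : ℕ) (y : Fin l → StrongDual ℝ X),
          BimonotoneFDD.IsCDecomposition E.dualProj c f y ∧
          BimonotoneFDD.IsAdmissible 𝒜 (fun i => BimonotoneFDD.supp E.dualProj (y i)),
      ∃ α < Ordinal.omega 1, ∃ (c : Set.Ioo (0 : ℝ) 1) (C : ℝ) (m : ℕ → ℕ), 1 ≤ C ∧ StrictMono m ∧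
        E.HasUpperEstimates C fun i =>
          BimonotoneFDD.tsirelsonBasis (BimonotoneFDD.schreier φ α) c (m i)
    ] := by
  tfae_have 1 → 2 := fun h c hc _ => hE.exists_isRegular_optMins h hc
  tfae_have 2 → 3 := fun h => by
    -- Any `c < 1` would do, since the finitely supported part of the dual ball is norming with `d =
    -- 1`.
    obtain ⟨𝒜, hA, hmem⟩ := h (1 / 2) (by norm_num) (by norm_num)
    exact ⟨_, 1 / 2, 1, 𝒜, fun f hf => hf, by norm_num, by norm_num, le_rfl, hA, hE.isNorming,
      fun f hf => BimonotoneFDD.exists_isCDecomposition_of_optMins E.isOrthogonal_dualProj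
        hE.isContractive_dualProj hf.2 (hmem f hf.1 hf.2)⟩
  tfae_have 3 → 4 := by
    rintro ⟨D, c, d, 𝒜, hD, hc, hcd, -, hA, hnorm, hdec⟩
    exact BimonotoneFDD.FDD.exists_hasUpperEstimates (fun f hf => (hD f hf).1) hc hcd hA hnorm hdec hφ
  tfae_have 4 → 1 := by
    rintro ⟨α, hα, c, C, m, hC, hm, h⟩
    exact hE.isShrinking_of_hasUpperEstimates BimonotoneFDD.isHereditary_schreier
      BimonotoneFDD.hasNoBranch_schreier (BimonotoneFDD.empty_mem_schreier hφ hα)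
      (zero_le_one.trans hC) hm h
  tfae_finish
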